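/- Let $X,Y$ be Polish spaces with Borel probability measures $\mu,\nu$, let $\Pi(\mu,\nu)$ be the set of Borel probability measures on $X\times Y$ with marginals $\mu$ and $\nu$, let $c:X\times Y\to[0,\infty]$ be Borel measurable, and let $\pi_0\in\Pi(\mu,\nu)$ satisfy $\int c\,d\pi_0<\infty$. Write $(\phi\oplus\psi)(x,y)=\phi(x)+\psi(y)$. Let $\Pi^{(\pi_0)}(\mu,\nu)$ be the set of $\pi\in\Pi(\mu,\nu)$ with $\pi\ll\pi_0$ and $\frac{d\pi}{d\pi_0}\in L^\infty(\pi_0)$, and put $$P^{(\pi_0)}=\inf\Big\{\int c\,d\pi:\ \pi\in\Pi^{(\pi_0)}(\mu,\nu)\Big\},\qquad D^{(\pi_0)}=\lim_{\varepsilon\downarrow0}D^{(\pi_0,\varepsilon)},$$ $$D^{(\pi_0,\varepsilon)}=\sup\Big\{\int\phi\,d\mu+\int\psi\,d\nu:\ \phi\in L^1(\mu),\ \psi\in L^1(\nu),\ \int(\phi\oplus\psi-c)_+\,d\pi_0\le\varepsilon\Big\}.$$ Let $L^1_S(\pi_0)$ be the closed linear subspace of $L^1(\pi_0)$ spanned by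 the functions $\phi\oplus\psi$ with $\phi\in L^1(\mu)$, $\psi\in L^1(\nu)$; its bidual is regarded as a subspace of $L^1(\pi_0)^{**}=L^\infty(\pi_0)^*$, and a plan $\pi\in\Pi^{(\pi_0)}(\mu,\nu)$ is identified with $\frac{d\pi}{d\pi_0}\in L^\infty(\pi_0)$. An element $s\in L^\infty(\pi_0)^*$ is said to vanish on a set $B$ if $\langle s,\gamma\rangle=0$ for every $\gamma\in L^\infty(\pi_0)$ that is zero $\pi_0$-a.e. outside $B$. It is purely singular if there are measurable sets $A_1\supseteq A_2\supseteq\cdots$ with $\pi_0(A_k)\to0$ such that $s$ vanishes on the complement of every $A_k$. Each $h\in L^\infty(\pi_0)^*$ decomposes uniquely as $h=h^r+h^s$ with $h^r\in L^1(\pi_0)$ and $h^s$ purely singular. Then the limit defining $D^{(\pi_0)}$ exists and $P^{(\pi_0)}=D^{(\pi_0)}$. Moreover, there is $\hat h\in L^1_S(\pi_0)^{**}$ with the following properties. 1. $\hat h\le c$ in the Banach lattice $L^1(\pi_0)^{**}$ (so that $\hat h^r\le c$ $\pi_0$-a.s. and $\hat h^s\le0$), and $D^{(\pi_0)}=\langle\hat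 h,\pi_0\rangle$. 2. If $\pi\in\Pi^{(\pi_0)}(\mu,\nu)$ and $\alpha\ge0$ satisfy $\int c\,d\pi\le P^{(\pi_0)}+\alpha$, then $-\alpha\le\langle\hat h^s,\pi\rangle\le0$. In particular, if $\pi\in\Pi^{(\pi_0)}(\mu,\nu)$ satisfies $\int c\,d\pi=P^{(\pi_0)}$, then $\hat h^s$ vanishes on the set $\{\frac{d\pi}{d\pi_0}>\varepsilon\}$ for every $\varepsilon>0$. 3. There are $(\phi_n,\psi_n)\in L^1(\mu)\times L^1(\nu)$, $n\in\mathbb N$, such that $\phi_n\oplus\psi_n\to\hat h^r$ $\pi_0$-a.s., $\|(\phi_n\oplus\psi_n-\hat h^r)_+\|_{L^1(\pi_0)}\to0$, and $$\lim_{\delta\downarrow0}\ \sup_{A:\ \pi_0(A)<\delta}\ \lim_{n\to\infty}\Big(-\int_A\phi_n\oplus\psi_n\,d\pi_0\Big)=\|\hat h^s\|_{L^1(\pi_0)^{**}},$$ where $A$ ranges over the measurable sets for which the inner limit exists; the same equality holds when $A$ ranges over all measurable sets and the inner limit is replaced by the limit inferior, and also when it is replaced by the limit superior. -/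

import Mathlib

open MeasureTheory Filter Topology Set
open scoped ENNReal NNReal

noncomputable section

namespace MongeKantorovich

variable {X Y : Type*} [MeasurableSpace X] [MeasurableSpace Y]

/-- The transport plans between `μ` and `ν`: probability measures on `X × Y` with these marginals. -/
def transportPlans (μ : Measure X) (ν : Measure Y) : Set (Measure (X × Y)) :=
  {π | IsProbabilityMeasure π ∧ π.fst = μ ∧ π.snd = ν}

/-- The transport plans of finite cost. -/
def finitePlans (μ : Measure X) (ν : Measure Y) (c : X × Y → ℝ≥0∞) : Set (Measure (X × Y)) :=
  {π | π ∈ transportPlans μ ν ∧ ∫⁻ z, c z ∂π < ∞}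

/-- The transport plans that are absolutely continuous with respect to `π₀` and whose
Radon-Nikodym derivative is essentially bounded. -/
def boundedPlans (μ : Measure X) (ν : Measure Y) (π₀ : Measure (X × Y)) :
    Set (Measure (X × Y)) :=
  {π | π ∈ transportPlans μ ν ∧ π ≪ π₀ ∧ essSup (π.rnDeriv π₀) π₀ < ∞}

/-- The primal value `P^(π₀)`. -/
def primalValue (μ : Measure X) (ν : Measure Y) (c : X × Y → ℝ≥0∞) (π₀ : Measure (X × Y)) :
    ℝ≥0∞ :=
  ⨅ π ∈ boundedPlans μ ν π₀, ∫⁻ z, c z ∂π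

/-- The function `φ ⊕ ψ`. -/
def oplus (φ : X → ℝ) (ψ : Y → ℝ) (z : X × Y) : ℝ := φ z.1 + ψ z.2

/-- The values `∫ φ dμ + ∫ ψ dν` of the pairs that violate `φ ⊕ ψ ≤ c` by at most `ε` in `L¹(π₀)`.
As `c ≥ 0`, the truncated subtraction of `ℝ≥0∞` makes the integrand `(φ ⊕ ψ - c)₊`, which is `0`
where `c = ∞`. -/
def relaxedDualValues (μ : Measure X) (ν : Measure Y) (c : X × Y → ℝ≥0∞) (π₀ : Measure (X × Y))
    (ε : ℝ) : Set EReal :=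
  {d | ∃ (φ : X → ℝ) (ψ : Y → ℝ), Integrable φ μ ∧ Integrable ψ ν ∧
    ∫⁻ z, (ENNReal.ofReal (oplus φ ψ z) - c z) ∂π₀ ≤ ENNReal.ofReal ε ∧
    d = ((∫ x, φ x ∂μ + ∫ y, ψ y ∂ν : ℝ) : EReal)}

/-- The relaxed dual value `D^(π₀, ε)`. -/
def relaxedDualValue (μ : Measure X) (ν : Measure Y) (c : X × Y → ℝ≥0∞) (π₀ : Measure (X × Y))
    (ε : ℝ) : EReal :=
  sSup (relaxedDualValues μ ν c π₀ ε)

/-- The dual value `D^(π₀)`, the limit of `D^(π₀, ε)` as `ε ↓ 0`. -/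
def dualValue (μ : Measure X) (ν : Measure Y) (c : X × Y → ℝ≥0∞) (π₀ : Measure (X × Y)) : EReal :=
  limUnder (𝓝[>] (0 : ℝ)) (relaxedDualValue μ ν c π₀)

/-- The closed linear subspace `L¹_S(π₀)` of `L¹(π₀)` spanned by the (classes of the) functions
`φ ⊕ ψ` with `φ ∈ L¹(μ)` and `ψ ∈ L¹(ν)`. -/
def L1S (μ : Measure X) (ν : Measure Y) (π₀ : Measure (X × Y)) : Submodule ℝ (Lp ℝ 1 π₀) :=
  (Submodule.span ℝ {f : Lp ℝ 1 π₀ | ∃ (φ : X → ℝ) (ψ : Y → ℝ),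
    Integrable φ μ ∧ Integrable ψ ν ∧ f =ᵐ[π₀] oplus φ ψ}).topologicalClosure

section Bidual

variable {Z : Type*} [MeasurableSpace Z]

/-- The canonical embedding of `L¹` into `(L^∞)^* = (L¹)^{**}`, `f ↦ (γ ↦ ∫ f γ dm)`. -/
def regular (m : Measure Z) : Lp ℝ 1 m →L[ℝ] StrongDual ℝ (Lp ℝ ∞ m) :=
  (ContinuousLinearMap.mul ℝ ℝ).lpPairing m 1 ∞

/-- The identification of `γ ∈ L^∞` with the functional `f ↦ ∫ f γ dm` in `(L¹)^*`. -/
def linftyToDual (m : Measure Z) : Lp ℝ ∞ m →L[ℝ] StrongDual ℝ (Lp ℝ 1 m) :=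
  (regular m).flip

/-- The embedding of the bidual of a subspace `E` of `L¹` into `(L^∞)^* = (L¹)^{**}`: the adjoint of
the map that sends `γ ∈ L^∞ = (L¹)^*` to its restriction to `E`. -/
def bidualEmb (m : Measure Z) (E : Submodule ℝ (Lp ℝ 1 m)) (h : StrongDual ℝ (StrongDual ℝ E)) :
    StrongDual ℝ (Lp ℝ ∞ m) :=
  h ∘L (ContinuousLinearMap.precomp ℝ E.subtypeL) ∘L linftyToDual m

/-- The lattice order of `(L^∞)^* = (L¹)^{**}`. -/
def DualLE {m : Measure Z} (g₁ g₂ : StrongDual ℝ (Lp ℝ ∞ m)) : Prop :=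
  ∀ γ : Lp ℝ ∞ m, 0 ≤ γ → g₁ γ ≤ g₂ γ

/-- `s` vanishes on the set `A`: it is zero on all elements of `L^∞` that are zero a.e. outside
`A`. -/
def VanishesOn {m : Measure Z} (s : StrongDual ℝ (Lp ℝ ∞ m)) (A : Set Z) : Prop :=
  ∀ γ : Lp ℝ ∞ m, (∀ᵐ z ∂m, z ∉ A → γ z = 0) → s γ = 0

/-- Purely singular elements of `(L^∞)^*`: those carried by each set of some decreasing sequence of
measurable sets whose measures tend to zero. -/
def PurelySingular {m : Measure Z} (s : StrongDual ℝ (Lp ℝ ∞ m)) : Prop :=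
  ∃ A : ℕ → Set Z, (∀ k, MeasurableSet (A k)) ∧ Antitone A ∧
    Tendsto (fun k => m (A k)) atTop (𝓝 0) ∧ ∀ k, VanishesOn s (A k)ᶜ

/-- `g` has regular part `r` and purely singular part `s`. -/
def IsDecomposition {m : Measure Z} (g : StrongDual ℝ (Lp ℝ ∞ m)) (r : Lp ℝ 1 m)
    (s : StrongDual ℝ (Lp ℝ ∞ m)) : Prop :=
  g = regular m r + s ∧ PurelySingular s

/-- The limit inferior of the masses that `-f n` puts on `A`, optimized over the sets `A` of measure
less than `δ`. -/
def escapeInf (m : Measure Z) (f : ℕ → Z → ℝ) (δ : ℝ≥0∞) : EReal :=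
  ⨆ (A : Set Z) (_ : MeasurableSet A) (_ : m A < δ),
    liminf (fun n => ((-∫ z in A, f n z ∂m : ℝ) : EReal)) atTop

/-- The same with the limit superior. -/
def escapeSup (m : Measure Z) (f : ℕ → Z → ℝ) (δ : ℝ≥0∞) : EReal :=
  ⨆ (A : Set Z) (_ : MeasurableSet A) (_ : m A < δ),
    limsup (fun n => ((-∫ z in A, f n z ∂m : ℝ) : EReal)) atTop

/-- The same with the limit, over those `A` for which this limit exists. -/
def escapeLim (m : Measure Z) (f : ℕ → Z → ℝ) (δ : ℝ≥0∞) : EReal :=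
  ⨆ (A : Set Z) (_ : MeasurableSet A) (_ : m A < δ) (l : ℝ)
    (_ : Tendsto (fun n => -∫ z in A, f n z ∂m) atTop (𝓝 l)), (l : EReal)

end Bidual

theorem memLp_density {μ : Measure X} {ν : Measure Y} {π₀ π : Measure (X × Y)}
    (hπ : π ∈ boundedPlans μ ν π₀) : MemLp (fun z => (π.rnDeriv π₀ z).toReal) ∞ π₀ := by
  refine memLp_top_of_bound (Measure.measurable_rnDeriv π π₀).ennreal_toReal.aestronglyMeasurable
    (essSup (π.rnDeriv π₀) π₀).toReal ?_
  filter_upwards [ENNReal.ae_le_essSup (μ := π₀) (π.rnDeriv π₀)] with z hz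
  rw [Real.norm_of_nonneg ENNReal.toReal_nonneg]
  exact ENNReal.toReal_mono hπ.2.2.ne hz

/-- The class of `dπ/dπ₀` in `L^∞(π₀)`. -/
def density {μ : Measure X} {ν : Measure Y} {π₀ π : Measure (X × Y)}
    (hπ : π ∈ boundedPlans μ ν π₀) : Lp ℝ ∞ π₀ :=
  (memLp_density hπ).toLp _

theorem memLp_cost {μ : Measure X} {ν : Measure Y} {c : X × Y → ℝ≥0∞} {π₀ : Measure (X × Y)}
    (hc : Measurable c) (hπ₀ : π₀ ∈ finitePlans μ ν c) :
    MemLp (fun z => (c z).toReal) 1 π₀ :=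
  memLp_one_iff_integrable.2 (integrable_toReal_of_lintegral_ne_top hc.aemeasurable hπ₀.2.ne)

/-- The class of the (`π₀`-a.e. finite) function `c` in `L¹(π₀)`. -/
def costClass {μ : Measure X} {ν : Measure Y} {c : X × Y → ℝ≥0∞} {π₀ : Measure (X × Y)}
    (hc : Measurable c) (hπ₀ : π₀ ∈ finitePlans μ ν c) : Lp ℝ 1 π₀ :=
  (memLp_cost hc hπ₀).toLp _

theorem mem_boundedPlans_self {μ : Measure X} {ν : Measure Y} {c : X × Y → ℝ≥0∞}
    {π₀ : Measure (X × Y)} (hπ₀ : π₀ ∈ finitePlans μ ν c) : π₀ ∈ boundedPlans μ ν π₀ := by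
  have := hπ₀.1.1
  refine ⟨hπ₀.1, Measure.AbsolutelyContinuous.refl _, ?_⟩
  refine lt_of_le_of_lt (essSup_le_of_ae_le 1 ?_) ENNReal.one_lt_top
  filter_upwards [Measure.rnDeriv_self π₀] with z hz
  simp [hz]

end MongeKantorovich

end

open MongeKantorovich

/-!
Let `P` be the primal value. A nonnegative `γ ∈ L^∞(π₀)` orthogonal to the functions `φ ⊕ ψ` of mean
zero is a multiple of the density of a bounded plan, so `P · ∫ γ dπ₀ ≤ ∫ c γ dπ₀` for such `γ`. By
the M. Riesz extension theorem, the difference extends to a positive functional `g` on `L^∞(π₀)`.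
Then `h = c - g` vanishes on the annihilator of `L¹_S(π₀)`, so it belongs to the bidual of
`L¹_S(π₀)`; it satisfies `h ≤ c`, and `⟨h, π⟩ = P` for every bounded plan `π`.

Write `h = r + s` for its Yosida-Hewitt decomposition; since `h ≤ c`, also `r ≤ c` and `s ≤ 0`. Let
`A` be a set of small measure that carries `s`. By Hahn-Banach, `r` lies in the `L¹`-closure of the
sums of a function `φ ⊕ ψ` and a density `u ≥ 0` on `A` of mass `‖s‖`: at every `γ ∈ L^∞(π₀)`
orthogonal to all `φ ⊕ ψ`, the functionals `r` and `-s` agree, and `-s` is positive, of mass `‖s‖`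
and carried by `A`. Letting `A` shrink along a summable sequence yields functions `φₙ ⊕ ψₙ` that
converge to `r` while the mass `‖s‖` escapes to `-∞` on vanishing sets. These are admissible for the
relaxed dual problems up to an error tending to zero and have dual values tending to `P`, so there
is no duality gap.
-/

noncomputable section

namespace MongeKantorovich

section LInfty

variable {Z : Type*} [MeasurableSpace Z] {m : Measure Z}

theorem regular_apply (f : Lp ℝ 1 m) (γ : Lp ℝ ∞ m) : regular m f γ = ∫ z, f z * γ z ∂m :=
  (ContinuousLinearMap.mul ℝ ℝ).lpPairing_eq_integral f γ

theorem linftyToDual_apply (γ : Lp ℝ ∞ m) (f : Lp ℝ 1 m) :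
    linftyToDual m γ f = ∫ z, f z * γ z ∂m :=
  regular_apply f γ

theorem integrable_mul_linfty {f : Z → ℝ} (hf : Integrable f m) (γ : Lp ℝ ∞ m) :
    Integrable (fun z => f z * γ z) m :=
  memLp_one_iff_integrable.1 ((Lp.memLp γ).mul (memLp_one_iff_integrable.2 hf))

theorem ae_abs_le_norm (γ : Lp ℝ ∞ m) : ∀ᵐ z ∂m, |γ z| ≤ ‖γ‖ := by
  filter_upwards [ae_le_eLpNormEssSup (f := γ) (μ := m)] with z hz
  rw [← eLpNorm_exponent_top] at hz
  simpa [Lp.norm_def] using ENNReal.toReal_mono (Lp.eLpNorm_ne_top γ) hz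

variable [IsFiniteMeasure m]

/-- The constant function `1` as an element of `L^∞(m)`. -/
def linftyOne (m : Measure Z) [IsFiniteMeasure m] : Lp ℝ ∞ m := Lp.const ∞ m 1

/-- The indicator function of a measurable set as an element of `L^∞(m)`. -/
def linftyIndicator (m : Measure Z) [IsFiniteMeasure m] {A : Set Z} (hA : MeasurableSet A) :
    Lp ℝ ∞ m :=
  indicatorConstLp ∞ hA (measure_ne_top m A) 1

theorem coeFn_linftyOne : linftyOne m =ᵐ[m] fun _ => 1 := Lp.coeFn_const ..

theorem coeFn_linftyIndicator {A : Set Z} (hA : MeasurableSet A) :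
    linftyIndicator m hA =ᵐ[m] A.indicator fun _ => 1 :=
  indicatorConstLp_coeFn

theorem linftyIndicator_univ : linftyIndicator m MeasurableSet.univ = linftyOne m :=
  indicatorConstLp_univ ..

theorem linftyIndicator_nonneg {A : Set Z} (hA : MeasurableSet A) :
    0 ≤ linftyIndicator m hA := by
  rw [← Lp.coeFn_nonneg]
  filter_upwards [coeFn_linftyIndicator (m := m) hA] with z hz
  rw [hz]
  exact indicator_nonneg (fun _ _ => zero_le_one) z

theorem linftyOne_nonneg : 0 ≤ linftyOne m :=
  linftyIndicator_univ (m := m) ▸ linftyIndicator_nonneg MeasurableSet.univ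

theorem norm_linftyOne_le : ‖linftyOne m‖ ≤ 1 := by
  simpa [linftyOne] using Lp.norm_const_le (p := ∞) (μ := m) (c := (1 : ℝ))

theorem le_norm_smul_linftyOne (γ : Lp ℝ ∞ m) : γ ≤ ‖γ‖ • linftyOne m := by
  rw [← Lp.coeFn_le]
  filter_upwards [ae_abs_le_norm γ, Lp.coeFn_smul ‖γ‖ (linftyOne m), coeFn_linftyOne (m := m)]
    with z hγ hsmul hone
  simpa [hsmul, hone] using (le_abs_self _).trans hγ

theorem regular_linftyOne (f : Lp ℝ 1 m) : regular m f (linftyOne m) = ∫ z, f z ∂m := by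
  rw [regular_apply]
  refine integral_congr_ae ?_
  filter_upwards [coeFn_linftyOne (m := m)] with z hz
  rw [hz, mul_one]

theorem regular_linftyIndicator (f : Lp ℝ 1 m) {A : Set Z} (hA : MeasurableSet A) :
    regular m f (linftyIndicator m hA) = ∫ z in A, f z ∂m := by
  rw [regular_apply, ← integral_indicator hA]
  refine integral_congr_ae ?_
  filter_upwards [coeFn_linftyIndicator (m := m) hA] with z hz
  by_cases h : z ∈ A <;> simp [hz, h]

end LInfty

section DualOfL1

variable {Z : Type*} [MeasurableSpace Z] {m : Measure Z} [IsFiniteMeasure m]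

theorem exists_setIntegral_eq_dual (ℓ : StrongDual ℝ (Lp ℝ 1 m)) :
    ∃ γ : Z → ℝ, Integrable γ m ∧ ∀ (A : Set Z) (hA : MeasurableSet A),
      ∫ z in A, γ z ∂m = ℓ (indicatorConstLp 1 hA (measure_ne_top m A) 1) := by
  -- multiplication by the constant `1` is the inclusion of `L²` in `L¹`
  let B := ContinuousLinearMap.mul ℝ ℝ
  let ι : Lp ℝ 2 m →L[ℝ] Lp ℝ 1 m := B.holderL m 2 2 1 (Lp.const 2 m 1)
  let γ := (InnerProductSpace.toDual ℝ (Lp ℝ 2 m)).symm (ℓ ∘L ι)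
  refine ⟨γ, (Lp.memLp γ).integrable one_le_two, fun A hA => ?_⟩
  have hι : ι (indicatorConstLp 2 hA (measure_ne_top m A) 1) =
      indicatorConstLp 1 hA (measure_ne_top m A) 1 := by
    refine Lp.ext ?_
    filter_upwards [B.coeFn_holder (r := 1) (Lp.const 2 m (1 : ℝ))
        (indicatorConstLp 2 hA (measure_ne_top m A) 1), Lp.coeFn_const 2 m (1 : ℝ),
      indicatorConstLp_coeFn (p := 1) (hs := hA) (hμs := measure_ne_top m A) (c := (1 : ℝ)),
      indicatorConstLp_coeFn (p := 2) (hs := hA) (hμs := measure_ne_top m A) (c := (1 : ℝ))]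
      with z hmul hconst h₁ h₂
    refine hmul.trans ?_
    rw [hconst, h₁, h₂]
    exact one_mul _
  rw [← L2.inner_indicatorConstLp_one (𝕜 := ℝ) hA (measure_ne_top m A) γ, real_inner_comm,
    InnerProductSpace.toDual_symm_apply, ContinuousLinearMap.comp_apply, hι]

theorem memLp_top_of_abs_setIntegral_le {γ : Z → ℝ} (hγ : Integrable γ m) {K : ℝ}
    (h : ∀ A, MeasurableSet A → |∫ z in A, γ z ∂m| ≤ K * m.real A) : MemLp γ ∞ m := by
  have hupper : γ ≤ᵐ[m] fun _ => K :=
    ae_le_of_forall_setIntegral_le hγ (integrable_const _) fun A hA _ => by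
      simpa [mul_comm] using (le_abs_self _).trans (h A hA)
  have hlower : (fun _ => -K) ≤ᵐ[m] γ :=
    ae_le_of_forall_setIntegral_le (integrable_const _) hγ fun A hA _ => by
      simpa [mul_comm] using (abs_le.1 (h A hA)).1
  refine memLp_top_of_bound hγ.aestronglyMeasurable K ?_
  filter_upwards [hupper, hlower] with z h₁ h₂ using abs_le.2 ⟨h₂, h₁⟩

theorem dual_ext_indicator {ℓ₁ ℓ₂ : StrongDual ℝ (Lp ℝ 1 m)}
    (h : ∀ (A : Set Z) (hA : MeasurableSet A),
      ℓ₁ (indicatorConstLp 1 hA (measure_ne_top m A) 1) =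
        ℓ₂ (indicatorConstLp 1 hA (measure_ne_top m A) 1)) : ℓ₁ = ℓ₂ := by
  ext f
  induction f using Lp.induction ENNReal.one_ne_top with
  | @indicatorConst a A hA hmA =>
    have hsmul : indicatorConstLp 1 hA hmA.ne a = a • indicatorConstLp 1 hA hmA.ne (1 : ℝ) := by
      rw [indicatorConstLp, indicatorConstLp, ← MemLp.toLp_const_smul]
      refine MemLp.toLp_congr _ _ (ae_of_all _ fun z => ?_)
      rw [Pi.smul_apply, ← indicator_const_smul_apply, smul_eq_mul, mul_one]
    rw [Lp.simpleFunc.coe_indicatorConst, hsmul, map_smul, map_smul, h A hA]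
  | add hf hg _ hf' hg' => rw [map_add, map_add, hf', hg']
  | isClosed => exact isClosed_eq ℓ₁.continuous ℓ₂.continuous

theorem linftyToDual_surjective : Function.Surjective (linftyToDual m) := by
  intro ℓ
  obtain ⟨γ, hγ, hℓ⟩ := exists_setIntegral_eq_dual ℓ
  have hbound : ∀ A, MeasurableSet A → |∫ z in A, γ z ∂m| ≤ ‖ℓ‖ * m.real A := fun A hA => by
    refine (congrArg _ (hℓ A hA)).le.trans ((ℓ.le_opNorm _).trans_eq ?_)
    rw [norm_indicatorConstLp one_ne_zero ENNReal.one_ne_top]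
    simp
  have hmem := memLp_top_of_abs_setIntegral_le hγ hbound
  refine ⟨hmem.toLp γ, dual_ext_indicator fun A hA => ?_⟩
  rw [linftyToDual_apply, ← hℓ A hA, ← integral_indicator hA]
  refine integral_congr_ae ?_
  filter_upwards [hmem.coeFn_toLp,
    indicatorConstLp_coeFn (p := 1) (hs := hA) (hμs := measure_ne_top m A) (c := (1 : ℝ))]
    with z h₁ h₂
  by_cases h : z ∈ A <;> simp [h₁, h₂, h]

end DualOfL1

section Positive

variable {Z : Type*} [MeasurableSpace Z] {m : Measure Z} {g : StrongDual ℝ (Lp ℝ ∞ m)}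

theorem DualLE.monotone (hg : DualLE 0 g) : Monotone g := fun γ₁ γ₂ h =>
  sub_nonneg.1 (map_sub g γ₂ γ₁ ▸ hg _ (sub_nonneg.2 h))

theorem DualLE.eq_zero_of_abs_le (hg : DualLE 0 g) {w γ : Lp ℝ ∞ m} (hw : g w = 0) {a : ℝ}
    (h : ∀ᵐ z ∂m, |γ z| ≤ a * w z) : g γ = 0 := by
  have hle : g |γ| ≤ g (a • w) := by
    refine hg.monotone ?_
    rw [← Lp.coeFn_le]
    filter_upwards [h, Lp.coeFn_smul a w, Lp.coeFn_abs γ] with z hz hsmul habs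
    rwa [hsmul, habs]
  rw [map_smul, hw, smul_zero] at hle
  refine le_antisymm ((hg.monotone (le_abs_self γ)).trans hle) ?_
  have hneg := (hg.monotone (neg_le_abs γ)).trans hle
  rw [map_neg] at hneg
  exact neg_nonpos.1 hneg

theorem DualLE.vanishesOn (hg : DualLE 0 g) {w : Lp ℝ ∞ m} (hw0 : 0 ≤ w) (hw : g w = 0)
    {A : Set Z} {a : ℝ} (ha : 0 < a) (h : ∀ᵐ z ∂m, z ∈ A → a ≤ w z) : VanishesOn g A := by
  refine fun γ hγ => hg.eq_zero_of_abs_le hw (a := ‖γ‖ / a) ?_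
  filter_upwards [h, hγ, ae_abs_le_norm γ, (Lp.coeFn_nonneg w).2 hw0] with z hz hγz hle hwz
  by_cases hzA : z ∈ A
  · rw [div_mul_eq_mul_div, le_div_iff₀ ha]
    exact mul_le_mul hle (hz hzA) ha.le (norm_nonneg γ)
  · rw [hγz hzA, abs_zero]
    exact mul_nonneg (by positivity) hwz

theorem DualLE.le_of_le_on_compl (hg : DualLE 0 g) {A : Set Z} (hA : VanishesOn g A)
    {γ₁ γ₂ : Lp ℝ ∞ m} (h : ∀ᵐ z ∂m, z ∉ A → γ₁ z ≤ γ₂ z) : g γ₁ ≤ g γ₂ := by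
  have hsup : g (γ₁ ⊔ γ₂ - γ₂) = 0 := hA _ <| by
    filter_upwards [h, Lp.coeFn_sub (γ₁ ⊔ γ₂) γ₂, Lp.coeFn_sup γ₁ γ₂] with z hz hsub hsup hzA
    rw [hsub, Pi.sub_apply, hsup, Pi.sup_apply, sup_of_le_right (hz hzA), sub_self]
  rw [map_sub, sub_eq_zero] at hsup
  exact hsup ▸ hg.monotone le_sup_left

variable [IsFiniteMeasure m]

theorem abs_le_norm_mul_of_nonneg {g : Lp ℝ ∞ m →ₗ[ℝ] ℝ} (hg : ∀ γ, 0 ≤ γ → 0 ≤ g γ)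
    (γ : Lp ℝ ∞ m) : |g γ| ≤ ‖γ‖ * g (linftyOne m) := by
  have hle (γ : Lp ℝ ∞ m) : g γ ≤ ‖γ‖ * g (linftyOne m) := by
    have h := hg _ (sub_nonneg.2 (le_norm_smul_linftyOne γ))
    rwa [map_sub, map_smul, smul_eq_mul, sub_nonneg] at h
  refine abs_le'.2 ⟨hle γ, ?_⟩
  have h := hle (-γ)
  rwa [map_neg, norm_neg] at h

theorem DualLE.norm_eq (hg : DualLE 0 g) : ‖g‖ = g (linftyOne m) := by
  refine le_antisymm (g.opNorm_le_bound (hg _ linftyOne_nonneg) fun γ => ?_) ?_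
  · rw [mul_comm]
    exact abs_le_norm_mul_of_nonneg (g := g.toLinearMap) hg γ
  · calc g (linftyOne m) ≤ ‖g‖ * ‖linftyOne m‖ := (le_abs_self _).trans (g.le_opNorm _)
      _ ≤ ‖g‖ := mul_le_of_le_one_right (norm_nonneg g) norm_linftyOne_le

end Positive

section YosidaHewitt

variable {Z : Type*} [MeasurableSpace Z] {m : Measure Z}

theorem VanishesOn.neg {s : StrongDual ℝ (Lp ℝ ∞ m)} {A : Set Z} (hs : VanishesOn s A) :
    VanishesOn (-s) A := fun γ hγ => by
  rw [neg_apply, hs γ hγ, neg_zero]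

theorem PurelySingular.neg {s : StrongDual ℝ (Lp ℝ ∞ m)} (hs : PurelySingular s) :
    PurelySingular (-s) := by
  obtain ⟨A, hAm, hAanti, hA0, hsA⟩ := hs
  exact ⟨A, hAm, hAanti, hA0, fun k => (hsA k).neg⟩

theorem DualLE.neg {g₁ g₂ : StrongDual ℝ (Lp ℝ ∞ m)} (h : DualLE g₁ g₂) :
    DualLE (-g₂) (-g₁) := fun γ hγ => neg_le_neg (h γ hγ)

theorem DualLE.zero_le_neg {g : StrongDual ℝ (Lp ℝ ∞ m)} (h : DualLE g 0) : DualLE 0 (-g) := by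
  simpa only [neg_zero] using h.neg

theorem regular_mono {f g : Lp ℝ 1 m} (h : f ≤ g) : DualLE (regular m f) (regular m g) :=
  fun γ hγ => by
    rw [regular_apply, regular_apply]
    refine integral_mono_ae (integrable_mul_linfty (L1.integrable_coeFn f) γ)
      (integrable_mul_linfty (L1.integrable_coeFn g) γ) ?_
    filter_upwards [(Lp.coeFn_le f g).2 h, (Lp.coeFn_nonneg γ).2 hγ] with z hle hpos
    exact mul_le_mul_of_nonneg_right hle hpos

variable [IsFiniteMeasure m]

theorem DualLE.norm_eq_neg {g : StrongDual ℝ (Lp ℝ ∞ m)} (h : DualLE g 0) :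
    ‖g‖ = -g (linftyOne m) := by
  rw [← norm_neg, h.zero_le_neg.norm_eq, neg_apply]

theorem linftyIndicator_inter_add_diff {A B : Set Z} (hA : MeasurableSet A)
    (hB : MeasurableSet B) : linftyIndicator m (hA.inter hB) + linftyIndicator m (hA.diff hB) =
      linftyIndicator m hA := by
  refine Lp.ext ?_
  filter_upwards [Lp.coeFn_add (linftyIndicator m (hA.inter hB)) (linftyIndicator m (hA.diff hB)),
    coeFn_linftyIndicator (m := m) (hA.inter hB), coeFn_linftyIndicator (m := m) (hA.diff hB),
    coeFn_linftyIndicator (m := m) hA] with z hadd hinter hdiff hind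
  rw [hadd, Pi.add_apply, hinter, hdiff, hind]
  by_cases hzA : z ∈ A <;> by_cases hzB : z ∈ B <;> simp [hzA, hzB]

theorem linftyIndicator_mono {A B : Set Z} (hA : MeasurableSet A) (hB : MeasurableSet B)
    (h : A ⊆ B) : linftyIndicator m hA ≤ linftyIndicator m hB := by
  rw [← Lp.coeFn_le]
  filter_upwards [coeFn_linftyIndicator (m := m) hA, coeFn_linftyIndicator (m := m) hB]
    with z h₁ h₂
  rw [h₁, h₂]
  exact indicator_le_indicator_of_subset h (fun _ => zero_le_one) z

theorem linftyIndicator_union_le {A B : Set Z} (hA : MeasurableSet A) (hB : MeasurableSet B) :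
    linftyIndicator m (hA.union hB) ≤ linftyIndicator m hA + linftyIndicator m hB := by
  rw [← Lp.coeFn_le]
  filter_upwards [Lp.coeFn_add (linftyIndicator m hA) (linftyIndicator m hB),
    coeFn_linftyIndicator (m := m) (hA.union hB), coeFn_linftyIndicator (m := m) hA,
    coeFn_linftyIndicator (m := m) hB] with z hadd hunion h₁ h₂
  rw [hadd, Pi.add_apply, hunion, h₁, h₂]
  by_cases hzA : z ∈ A <;> by_cases hzB : z ∈ B <;> simp [hzA, hzB]

theorem linftyIndicator_eq_zero {A : Set Z} (hA : MeasurableSet A) (h : m A = 0) :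
    linftyIndicator m hA = 0 := by
  refine Lp.ext ?_
  filter_upwards [coeFn_linftyIndicator (m := m) hA, Lp.coeFn_zero ℝ ∞ m,
    measure_eq_zero_iff_ae_notMem.1 h] with z hind hzero hz
  rw [hind, hzero, indicator_of_notMem hz, Pi.zero_apply]

theorem measurableSet_accumulate {t : ℕ → Set Z} (ht : ∀ i, MeasurableSet (t i)) (n : ℕ) :
    MeasurableSet (accumulate t n) :=
  MeasurableSet.biUnion (to_countable _) fun i _ => ht i

section Positivity

variable {s : StrongDual ℝ (Lp ℝ ∞ m)}

/- Subtracting `M / 2` on the set where `γ ≥ M / 2` halves the bound `M` and does not increase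
`s γ`. -/
theorem neg_norm_mul_le_of_indicator_nonneg
    (hs : ∀ (A : Set Z) (hA : MeasurableSet A), 0 ≤ s (linftyIndicator m hA)) (n : ℕ) :
    ∀ {M : ℝ} {γ : Lp ℝ ∞ m}, 0 ≤ M → (∀ᵐ z ∂m, 0 ≤ γ z ∧ γ z ≤ M) →
      -(‖s‖ * (M / 2 ^ n)) ≤ s γ := by
  induction n with
  | zero =>
    intro M γ hM hγ
    have hnorm : ‖γ‖ ≤ M := by
      simpa using Lp.norm_le_of_ae_bound hM (f := γ) <| by
        filter_upwards [hγ] with z hz using (Real.norm_of_nonneg hz.1).trans_le hz.2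
    rw [pow_zero, div_one]
    exact (abs_le.1 ((s.le_opNorm γ).trans (by gcongr))).1
  | succ n ih =>
    intro M γ hM hγ
    have hA : MeasurableSet {z | M / 2 ≤ γ z} :=
      measurableSet_le measurable_const (Lp.stronglyMeasurable γ).measurable
    have hγ' : ∀ᵐ z ∂m, 0 ≤ (γ - (M / 2) • linftyIndicator m hA : Lp ℝ ∞ m) z ∧
        (γ - (M / 2) • linftyIndicator m hA : Lp ℝ ∞ m) z ≤ M / 2 := by
      filter_upwards [hγ, Lp.coeFn_sub γ ((M / 2) • linftyIndicator m hA),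
        Lp.coeFn_smul (M / 2) (linftyIndicator m hA), coeFn_linftyIndicator (m := m) hA]
        with z hz hsub hsmul hind
      rw [hsub, Pi.sub_apply, hsmul, Pi.smul_apply, hind, smul_eq_mul]
      by_cases hzA : M / 2 ≤ γ z
      · rw [indicator_of_mem (by exact hzA)]
        constructor <;> linarith
      · rw [indicator_of_notMem (by exact hzA)]
        constructor <;> linarith
    have hle := ih (div_nonneg hM zero_le_two) hγ'
    rw [map_sub, map_smul, smul_eq_mul, div_div, ← pow_succ'] at hle
    linarith [mul_nonneg (by positivity : 0 ≤ M / 2) (hs _ hA)]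

theorem dualLE_zero_of_indicator_nonneg
    (hs : ∀ (A : Set Z) (hA : MeasurableSet A), 0 ≤ s (linftyIndicator m hA)) :
    DualLE 0 s := by
  intro γ hγ
  have hbound : ∀ᵐ z ∂m, 0 ≤ γ z ∧ γ z ≤ ‖γ‖ := by
    filter_upwards [(Lp.coeFn_nonneg γ).2 hγ, ae_abs_le_norm γ] with z hz habs
    exact ⟨hz, (le_abs_self _).trans habs⟩
  have hlim : Tendsto (fun n : ℕ => -(‖s‖ * (‖γ‖ / 2 ^ n))) atTop (𝓝 0) := by
    simpa [div_eq_mul_inv] using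
      (((tendsto_pow_atTop_nhds_zero_of_lt_one (r := (2 : ℝ)⁻¹) (by norm_num)
        (by norm_num)).const_mul ‖γ‖).const_mul ‖s‖).neg
  exact le_of_tendsto' hlim fun n => neg_norm_mul_le_of_indicator_nonneg hs n (norm_nonneg γ) hbound

theorem DualLE.indicator_nonneg (hs : DualLE 0 s) {A : Set Z} (hA : MeasurableSet A) :
    0 ≤ s (linftyIndicator m hA) :=
  hs _ (linftyIndicator_nonneg hA)

theorem DualLE.indicator_accumulate_le (hs : DualLE 0 s) {t : ℕ → Set Z}
    (ht : ∀ i, MeasurableSet (t i)) (n : ℕ) :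
    s (linftyIndicator m (measurableSet_accumulate ht n)) ≤
      ∑ i ∈ Finset.range (n + 1), s (linftyIndicator m (ht i)) := by
  induction n with
  | zero => simp [accumulate_zero_nat]
  | succ n ih =>
    rw [Finset.sum_range_succ]
    have hle := hs.monotone (linftyIndicator_union_le (m := m) (measurableSet_accumulate ht n)
      (ht (n + 1)))
    rw [map_add] at hle
    simp only [accumulate_succ]
    exact hle.trans (by gcongr)

theorem DualLE.purelySingular (hs : DualLE 0 s)
    (h : ∀ ε : ℝ≥0∞, ε ≠ 0 → ∀ η : ℝ, 0 < η →
      ∃ (A : Set Z) (hA : MeasurableSet A), m Aᶜ ≤ ε ∧ s (linftyIndicator m hA) ≤ η) :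
    PurelySingular s := by
  obtain ⟨δ, hδ0, hδ⟩ := ENNReal.exists_pos_sum_of_countable (ε := 1) one_ne_zero ℕ
  choose A hA hmA hsA using fun j : ℕ => h (δ j) (by exact_mod_cast (hδ0 j).ne')
    (1 / ((j : ℝ) + 1)) (by positivity)
  have hT (k : ℕ) : MeasurableSet (⋃ j, (A (j + k))ᶜ) := MeasurableSet.iUnion fun j => (hA _).compl
  refine ⟨fun k => ⋃ j, (A (j + k))ᶜ, hT, ?_, ?_, fun k => ?_⟩
  · refine antitone_nat_of_succ_le fun k => iUnion_subset fun j => ?_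
    rw [show j + (k + 1) = j + 1 + k by ring]
    exact subset_iUnion (fun j => (A (j + k))ᶜ) (j + 1)
  · refine tendsto_of_tendsto_of_tendsto_of_le_of_le tendsto_const_nhds
      (ENNReal.tendsto_sum_nat_add (fun j => (δ j : ℝ≥0∞)) (hδ.trans ENNReal.one_lt_top).ne)
      (fun _ => zero_le) fun k => ?_
    exact (measure_iUnion_le _).trans (ENNReal.tsum_le_tsum fun j => hmA _)
  · have hle (j : ℕ) : s (linftyIndicator m (hT k).compl) ≤ 1 / (((j + k : ℕ) : ℝ) + 1) :=
      (hs.monotone (linftyIndicator_mono _ _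
        (compl_subset_comm.1 (subset_iUnion (fun j => (A (j + k))ᶜ) j)))).trans (hsA _)
    have hzero : s (linftyIndicator m (hT k).compl) = 0 :=
      le_antisymm (ge_of_tendsto' ((tendsto_add_atTop_iff_nat k).2
        tendsto_one_div_add_atTop_nhds_zero_nat) hle) (hs.indicator_nonneg _)
    refine hs.vanishesOn (linftyIndicator_nonneg _) hzero one_pos ?_
    filter_upwards [coeFn_linftyIndicator (m := m) (hT k).compl] with z hz hzT
    rw [hz, indicator_of_mem hzT]

end Positivity

section SigmaAdditivePart

variable {g : StrongDual ℝ (Lp ℝ ∞ m)}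

/-- The finitely additive set function `A ↦ g(1_A)` of a positive functional `g` on `L^∞`; it is
given the value `∞` on nonmeasurable sets, so that only measurable covers count in the outer measure
that it generates. -/
def charge (g : StrongDual ℝ (Lp ℝ ∞ m)) : Set Z → ℝ≥0∞ :=
  extend fun (A : Set Z) (hA : MeasurableSet A) => ENNReal.ofReal (g (linftyIndicator m hA))

theorem charge_apply (g : StrongDual ℝ (Lp ℝ ∞ m)) {A : Set Z} (hA : MeasurableSet A) :
    charge g A = ENNReal.ofReal (g (linftyIndicator m hA)) :=
  extend_eq _ hA

theorem charge_empty (g : StrongDual ℝ (Lp ℝ ∞ m)) : charge g ∅ = 0 := by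
  rw [charge_apply g MeasurableSet.empty, linftyIndicator_eq_zero _ measure_empty, map_zero,
    ENNReal.ofReal_zero]

theorem charge_of_not_measurableSet (g : StrongDual ℝ (Lp ℝ ∞ m)) {A : Set Z}
    (hA : ¬MeasurableSet A) : charge g A = ∞ :=
  iInf_neg hA

theorem le_caratheodory_charge (hg : DualLE 0 g) :
    ‹MeasurableSpace Z› ≤ (OuterMeasure.ofFunction (charge g) (charge_empty g)).caratheodory := by
  refine fun A hA => OuterMeasure.ofFunction_caratheodory fun t => ?_
  by_cases ht : MeasurableSet t
  · rw [charge_apply g ht, charge_apply g (ht.inter hA), charge_apply g (ht.diff hA),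
      ← ENNReal.ofReal_add (hg.indicator_nonneg _) (hg.indicator_nonneg _), ← map_add,
      linftyIndicator_inter_add_diff ht hA]
  · rw [charge_of_not_measurableSet g ht]
    exact le_top

/-- The `σ`-additive part of a positive functional `g` on `L^∞`: the largest measure below its
charge. -/
def sigmaAdditivePart (hg : DualLE 0 g) : Measure Z :=
  (OuterMeasure.ofFunction (charge g) (charge_empty g)).toMeasure
    (le_caratheodory_charge hg)

variable (hg : DualLE 0 g)

theorem sigmaAdditivePart_le {A : Set Z} (hA : MeasurableSet A) :
    sigmaAdditivePart hg A ≤ ENNReal.ofReal (g (linftyIndicator m hA)) := by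
  rw [sigmaAdditivePart, toMeasure_apply _ _ hA, ← charge_apply g hA]
  exact OuterMeasure.ofFunction_le A

instance isFiniteMeasure_sigmaAdditivePart : IsFiniteMeasure (sigmaAdditivePart hg) :=
  ⟨(sigmaAdditivePart_le hg MeasurableSet.univ).trans_lt ENNReal.ofReal_lt_top⟩

theorem sigmaAdditivePart_absolutelyContinuous : sigmaAdditivePart hg ≪ m := by
  refine Measure.AbsolutelyContinuous.mk fun A hA h => ?_
  simpa [linftyIndicator_eq_zero hA h] using sigmaAdditivePart_le hg hA

theorem exists_cover_sigmaAdditivePart {η : ℝ≥0∞} (hη : η ≠ 0) :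
    ∃ (t : ℕ → Set Z) (ht : ∀ i, MeasurableSet (t i)), ⋃ i, t i = univ ∧
      ∑' i, ENNReal.ofReal (g (linftyIndicator m (ht i))) ≤
        sigmaAdditivePart hg univ + η := by
  have hlt := ENNReal.lt_add_right (measure_ne_top (sigmaAdditivePart hg) univ) hη
  conv_lhs at hlt =>
    rw [sigmaAdditivePart, toMeasure_apply _ _ MeasurableSet.univ,
      OuterMeasure.ofFunction_eq_iInf_mem _ _ fun A hA => charge_of_not_measurableSet g hA]
  simp only [iInf_lt_iff] at hlt
  obtain ⟨t, ht, hcov, hlt⟩ := hlt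
  refine ⟨t, ht, univ_subset_iff.1 hcov, ?_⟩
  simpa only [charge_apply g (ht _)] using hlt.le

/-- The density of the `σ`-additive part of a positive functional on `L^∞`: the regular part of its
Yosida-Hewitt decomposition. -/
def regularPart : Lp ℝ 1 m :=
  (memLp_one_iff_integrable.2 (Measure.integrable_toReal_rnDeriv (μ := sigmaAdditivePart hg)
    (ν := m))).toLp _

theorem coeFn_regularPart :
    regularPart hg =ᵐ[m] fun z => ((sigmaAdditivePart hg).rnDeriv m z).toReal :=
  MemLp.coeFn_toLp _

theorem regularPart_nonneg : 0 ≤ regularPart hg := by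
  rw [← Lp.coeFn_nonneg]
  filter_upwards [coeFn_regularPart hg] with z hz
  exact hz ▸ ENNReal.toReal_nonneg

theorem regular_regularPart_indicator {A : Set Z} (hA : MeasurableSet A) :
    regular m (regularPart hg) (linftyIndicator m hA) = (sigmaAdditivePart hg).real A := by
  rw [regular_linftyIndicator,
    ← Measure.setIntegral_toReal_rnDeriv (sigmaAdditivePart_absolutelyContinuous hg)]
  exact integral_congr_ae (ae_restrict_of_ae (coeFn_regularPart hg))

theorem regular_regularPart_le : DualLE 0 (g - regular m (regularPart hg)) :=
  dualLE_zero_of_indicator_nonneg fun A hA => by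
    rw [sub_apply, regular_regularPart_indicator, sub_nonneg]
    exact ENNReal.toReal_le_of_le_ofReal (hg.indicator_nonneg hA) (sigmaAdditivePart_le hg hA)

theorem exists_cover_sub_regularPart {η : ℝ≥0∞} (hη : η ≠ 0) (hη' : η ≠ ∞) :
    ∃ (t : ℕ → Set Z) (ht : ∀ i, MeasurableSet (t i)), ⋃ i, t i = univ ∧
      ∑' i, ENNReal.ofReal ((g - regular m (regularPart hg)) (linftyIndicator m (ht i))) ≤ η := by
  obtain ⟨t, ht, hcov, hsum⟩ := exists_cover_sigmaAdditivePart hg hη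
  refine ⟨t, ht, hcov, ?_⟩
  have hsplit (i : ℕ) : ENNReal.ofReal (g (linftyIndicator m (ht i))) = sigmaAdditivePart hg (t i) +
      ENNReal.ofReal ((g - regular m (regularPart hg)) (linftyIndicator m (ht i))) := by
    rw [← ofReal_measureReal, ← ENNReal.ofReal_add measureReal_nonneg
      ((regular_regularPart_le hg).indicator_nonneg _), sub_apply,
      regular_regularPart_indicator, add_sub_cancel]
  simp only [hsplit, ENNReal.tsum_add] at hsum
  have hle : sigmaAdditivePart hg univ ≤ ∑' i, sigmaAdditivePart hg (t i) :=
    hcov ▸ measure_iUnion_le t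
  have hfin : ∑' i, sigmaAdditivePart hg (t i) ≠ ∞ :=
    ne_top_of_le_ne_top (by finiteness) (le_self_add.trans hsum)
  exact (ENNReal.add_le_add_iff_left hfin).1 (hsum.trans (by gcongr))

theorem purelySingular_sub_regularPart : PurelySingular (g - regular m (regularPart hg)) := by
  refine (regular_regularPart_le hg).purelySingular fun ε hε η hη => ?_
  obtain ⟨t, ht, hcov, hsum⟩ := exists_cover_sub_regularPart hg (η := ENNReal.ofReal η)
    (by simpa using hη) ENNReal.ofReal_ne_top
  have hlim : Tendsto (fun n => m (accumulate t n)ᶜ) atTop (𝓝 0) := by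
    have hempty : ⋂ n, (accumulate t n)ᶜ = ∅ := by
      rw [← compl_iUnion, iUnion_accumulate, hcov, compl_univ]
    rw [← measure_empty (μ := m), ← hempty]
    exact tendsto_measure_iInter_atTop
      (fun n => (measurableSet_accumulate ht n).compl.nullMeasurableSet)
      (fun _ _ h => compl_subset_compl.2 (monotone_accumulate h)) ⟨0, measure_ne_top m _⟩
  obtain ⟨n, hn⟩ := (hlim.eventually_le_const hε.bot_lt).exists
  refine ⟨accumulate t n, measurableSet_accumulate ht n, hn, ?_⟩
  refine ((regular_regularPart_le hg).indicator_accumulate_le ht n).trans ?_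
  rw [← ENNReal.ofReal_le_ofReal_iff hη.le,
    ENNReal.ofReal_sum_of_nonneg fun i _ => (regular_regularPart_le hg).indicator_nonneg _]
  exact (ENNReal.sum_le_tsum _).trans hsum

end SigmaAdditivePart

theorem exists_isDecomposition_of_dualLE_regular {g : StrongDual ℝ (Lp ℝ ∞ m)} {f : Lp ℝ 1 m}
    (h : DualLE g (regular m f)) :
    ∃ (r : Lp ℝ 1 m) (s : StrongDual ℝ (Lp ℝ ∞ m)), IsDecomposition g r s ∧ r ≤ f ∧ DualLE s 0 := by
  have hpos : DualLE 0 (regular m f - g) := fun γ hγ => sub_nonneg.2 (h γ hγ)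
  refine ⟨f - regularPart hpos, -(regular m f - g - regular m (regularPart hpos)),
    ⟨?_, (purelySingular_sub_regularPart hpos).neg⟩,
    sub_le_self f (regularPart_nonneg hpos), ?_⟩
  · rw [map_sub]
    abel
  · simpa only [neg_zero] using (regular_regularPart_le hpos).neg

end YosidaHewitt

section Bidual

variable {Z : Type*} [MeasurableSpace Z] {m : Measure Z} {E : Submodule ℝ (Lp ℝ 1 m)}

/-- The restriction map `L^∞(m) = L¹(m)^* → E^*`; its adjoint is `bidualEmb m E`. -/
def restrictDual (m : Measure Z) (E : Submodule ℝ (Lp ℝ 1 m)) : Lp ℝ ∞ m →L[ℝ] StrongDual ℝ E :=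
  ContinuousLinearMap.precomp ℝ E.subtypeL ∘L linftyToDual m

/-- The annihilator of `E ⊆ L¹(m)` in `L^∞(m) = L¹(m)^*`. -/
def annihilator (m : Measure Z) (E : Submodule ℝ (Lp ℝ 1 m)) : Submodule ℝ (Lp ℝ ∞ m) :=
  (restrictDual m E).ker

theorem mem_annihilator {γ : Lp ℝ ∞ m} :
    γ ∈ annihilator m E ↔ ∀ f ∈ E, regular m f γ = 0 := by
  refine LinearMap.mem_ker.trans (ContinuousLinearMap.ext_iff.trans ?_)
  rw [Subtype.forall]
  rfl

theorem bidualEmb_eq_zero (h : StrongDual ℝ (StrongDual ℝ E)) {γ : Lp ℝ ∞ m}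
    (hγ : γ ∈ annihilator m E) : bidualEmb m E h γ = 0 :=
  (congrArg h hγ).trans h.map_zero

theorem annihilator_topologicalClosure :
    annihilator m E.topologicalClosure = annihilator m E := by
  ext γ
  rw [mem_annihilator, mem_annihilator]
  refine ⟨fun h f hf => h f (E.le_topologicalClosure hf), fun h => ?_⟩
  exact E.topologicalClosure_minimal (t := (linftyToDual m γ).ker) h
    (linftyToDual m γ).isClosed_ker

theorem restrictDual_surjective [IsFiniteMeasure m] : Function.Surjective (restrictDual m E) := by
  intro ℓ
  obtain ⟨ℓ', hℓ', -⟩ := exists_extension_norm_eq E ℓ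
  obtain ⟨γ, rfl⟩ := linftyToDual_surjective ℓ'
  exact ⟨γ, ContinuousLinearMap.ext hℓ'⟩

theorem exists_comp_eq_of_surjective {V W : Type*} [NormedAddCommGroup V] [NormedSpace ℝ V]
    [CompleteSpace V] [NormedAddCommGroup W] [NormedSpace ℝ W] [CompleteSpace W] {f : V →L[ℝ] W}
    (hf : Function.Surjective f) {g : StrongDual ℝ V} (h : ∀ v, f v = 0 → g v = 0) :
    ∃ k : StrongDual ℝ W, k ∘L f = g := by
  let k := f.ker.liftQ g.toLinearMap h ∘ₗ
    (f.toLinearMap.quotKerEquivOfSurjective hf).symm.toLinearMap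
  have hk (v : V) : k (f v) = g v := by
    have hv := LinearMap.quotKerEquivOfSurjective_symm_apply f.toLinearMap hf v
    exact (congrArg _ hv).trans (f.ker.liftQ_apply g.toLinearMap (h := h) v)
  have hcont : Continuous k :=
    (f.isQuotientMap hf).continuous_iff.2 ((funext hk : k ∘ f = g) ▸ g.continuous)
  exact ⟨⟨k, hcont⟩, ContinuousLinearMap.ext hk⟩

theorem exists_bidualEmb_eq [IsFiniteMeasure m] {g : StrongDual ℝ (Lp ℝ ∞ m)}
    (hg : ∀ γ ∈ annihilator m E, g γ = 0) : ∃ h, bidualEmb m E h = g :=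
  exists_comp_eq_of_surjective (W := StrongDual ℝ E) restrictDual_surjective hg

end Bidual

section DualAttainment

variable {Z : Type*} [MeasurableSpace Z] {m : Measure Z}

instance posSMulMono_Lp {p : ℝ≥0∞} : PosSMulMono ℝ (Lp ℝ p m) :=
  PosSMulMono.of_smul_nonneg fun a ha γ hγ => by
    rw [← Lp.coeFn_nonneg] at hγ ⊢
    filter_upwards [hγ, Lp.coeFn_smul a γ] with z hz hsmul
    rw [hsmul]
    exact smul_nonneg ha hz

variable [IsProbabilityMeasure m]

/-- The functional `γ ↦ ∫ γ dm` on `L^∞(m)`. -/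
def linftyIntegral (m : Measure Z) [IsProbabilityMeasure m] : StrongDual ℝ (Lp ℝ ∞ m) :=
  regular m (Lp.const 1 m 1)

theorem linftyIntegral_apply (γ : Lp ℝ ∞ m) : linftyIntegral m γ = ∫ z, γ z ∂m := by
  rw [linftyIntegral, regular_apply]
  refine integral_congr_ae ?_
  filter_upwards [Lp.coeFn_const 1 m (1 : ℝ)] with z hz
  rw [hz, Function.const_apply, one_mul]

theorem linftyIntegral_one : linftyIntegral m (linftyOne m) = 1 := by
  rw [linftyIntegral_apply, integral_congr_ae coeFn_linftyOne]
  simp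

theorem linftyIntegral_nonneg {γ : Lp ℝ ∞ m} (hγ : 0 ≤ γ) : 0 ≤ linftyIntegral m γ :=
  linftyIntegral_apply γ ▸ integral_nonneg_of_ae ((Lp.coeFn_nonneg γ).2 hγ)

theorem eq_zero_of_linftyIntegral_eq_zero {γ : Lp ℝ ∞ m} (hγ : 0 ≤ γ)
    (h : linftyIntegral m γ = 0) : γ = 0 := by
  rw [linftyIntegral_apply, integral_eq_zero_iff_of_nonneg_ae ((Lp.coeFn_nonneg γ).2 hγ)
    ((Lp.memLp γ).integrable le_top)] at h
  exact (Lp.eq_zero_iff_ae_eq_zero).2 h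

variable {E : Submodule ℝ (Lp ℝ 1 m)} {C : StrongDual ℝ (Lp ℝ ∞ m)} {P : ℝ}

theorem mul_linftyIntegral_le (hP : ∀ γ, 0 ≤ γ → γ - linftyOne m ∈ annihilator m E → P ≤ C γ)
    {γ : Lp ℝ ∞ m} (hγ : 0 ≤ γ)
    (hmem : γ - linftyIntegral m γ • linftyOne m ∈ annihilator m E) :
    P * linftyIntegral m γ ≤ C γ := by
  rcases (linftyIntegral_nonneg hγ).eq_or_lt' with hzero | hpos
  · rw [eq_zero_of_linftyIntegral_eq_zero hγ hzero, map_zero, map_zero, mul_zero]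
  · have hscale := hP _ (smul_nonneg (inv_nonneg.2 hpos.le) hγ) <| by
      simpa [smul_sub, smul_smul, hpos.ne'] using
        (annihilator m E).smul_mem (linftyIntegral m γ)⁻¹ hmem
    rwa [map_smul, smul_eq_mul, ← div_eq_inv_mul, le_div_iff₀ hpos] at hscale

theorem exists_nonneg_extension {D : Submodule ℝ (Lp ℝ ∞ m)} (hone : linftyOne m ∈ D)
    {f : StrongDual ℝ (Lp ℝ ∞ m)} (hf : ∀ γ ∈ D, 0 ≤ γ → 0 ≤ f γ) :
    ∃ g : StrongDual ℝ (Lp ℝ ∞ m), (∀ γ ∈ D, g γ = f γ) ∧ DualLE 0 g := by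
  obtain ⟨g, hgf, hg⟩ := riesz_extension (PointedCone.positive ℝ (Lp ℝ ∞ m))
    ⟨D, f.toLinearMap.domRestrict D⟩ (fun γ hγ => hf γ γ.2 hγ) fun γ =>
      ⟨⟨‖γ‖ • linftyOne m, D.smul_mem _ hone⟩, by
        simpa [neg_le_iff_add_nonneg] using le_norm_smul_linftyOne (-γ)⟩
  refine ⟨g.mkContinuous (g (linftyOne m)) fun γ => ?_, fun γ hγ => hgf ⟨γ, hγ⟩, hg⟩
  rw [mul_comm]
  exact abs_le_norm_mul_of_nonneg hg γ

theorem exists_bidual_le (hE : Lp.const 1 m 1 ∈ E)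
    (hP : ∀ γ, 0 ≤ γ → γ - linftyOne m ∈ annihilator m E → P ≤ C γ) :
    ∃ h, DualLE (bidualEmb m E h) C ∧ bidualEmb m E h (linftyOne m) = P := by
  let D := (annihilator m E).comap
    (LinearMap.id - (linftyIntegral m).toLinearMap.smulRight (linftyOne m))
  have hone : linftyOne m ∈ D := by
    simp [D, linftyIntegral_one]
  obtain ⟨g, hgD, hg⟩ := exists_nonneg_extension (f := C - P • linftyIntegral m) hone
    fun γ hγD hγ => sub_nonneg.2 (mul_linftyIntegral_le hP hγ hγD)
  obtain ⟨h, hh⟩ := exists_bidualEmb_eq (E := E) (g := C - g) fun γ hγ => by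
    have hint : linftyIntegral m γ = 0 := mem_annihilator.1 hγ _ hE
    have hγD : γ ∈ D := by simpa [D, hint] using hγ
    simp [hgD γ hγD, hint]
  refine ⟨h, fun γ hγ => ?_, ?_⟩
  · rw [hh]
    exact sub_le_self _ (hg γ hγ)
  · simp [hh, hgD _ hone, linftyIntegral_one]

end DualAttainment

section Separation

variable {V : Type*} [NormedAddCommGroup V] [NormedSpace ℝ V]

theorem dual_eq_zero_of_bddAbove {S : Submodule ℝ V} {ℓ : StrongDual ℝ V} {K : ℝ}
    (hK : ∀ f ∈ S, ℓ f ≤ K) {f : V} (hf : f ∈ S) : ℓ f = 0 := by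
  by_contra hne
  have h := hK _ (S.smul_mem ((K + 1) / ℓ f) hf)
  rw [map_smul, smul_eq_mul, div_mul_cancel₀ _ hne] at h
  linarith

open scoped Pointwise in
theorem mem_closure_add_submodule {U : Set V} (hU : Convex ℝ U) {S : Submodule ℝ V} {r : V}
    (h : ∀ (ℓ : StrongDual ℝ V) (t : ℝ), (∀ f ∈ S, ℓ f = 0) → (∀ u ∈ U, ℓ u ≤ t) → ℓ r ≤ t) :
    r ∈ closure (U + (S : Set V)) := by
  obtain ⟨u₀, hu₀⟩ : U.Nonempty := by
    by_contra hempty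
    have h0 := h 0 (-1) (fun _ _ => rfl) fun u hu => absurd ⟨u, hu⟩ hempty
    norm_num at h0
  by_contra hr
  obtain ⟨ℓ, t, hlt, htr⟩ := geometric_hahn_banach_closed_point
    (hU.add S.convex).closure isClosed_closure hr
  have hle : ∀ u ∈ U, ∀ f ∈ S, ℓ u + ℓ f ≤ t := fun u hu f hf =>
    (map_add ℓ u f).ge.trans (hlt _ (subset_closure (add_mem_add hu hf))).le
  refine htr.not_ge (h ℓ t (fun f => ?_) fun u hu => ?_)
  · exact dual_eq_zero_of_bddAbove (K := t - ℓ u₀) fun f hf => by linarith [hle u₀ hu₀ f hf]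
  · simpa using hle u hu 0 S.zero_mem

end Separation

section Approximation

variable {Z : Type*} [MeasurableSpace Z] {m : Measure Z}

/-- The nonnegative elements of `L¹(m)` of integral `a` that are carried by `A`. -/
def densitiesOn (m : Measure Z) (A : Set Z) (a : ℝ) : Set (Lp ℝ 1 m) :=
  {u | 0 ≤ u ∧ (∀ᵐ z ∂m, z ∉ A → u z = 0) ∧ ∫ z, u z ∂m = a}

theorem convex_densitiesOn (A : Set Z) (a : ℝ) : Convex ℝ (densitiesOn m A a) := by
  rintro u ⟨hu0, huA, hua⟩ v ⟨hv0, hvA, hva⟩ s t hs ht hst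
  have hcoe : ⇑(s • u + t • v) =ᵐ[m] fun z => s * u z + t * v z := by
    filter_upwards [Lp.coeFn_add (s • u) (t • v), Lp.coeFn_smul s u, Lp.coeFn_smul t v]
      with z hadd hsu htv
    rw [hadd, Pi.add_apply, hsu, htv]
    rfl
  refine ⟨add_nonneg (smul_nonneg hs hu0) (smul_nonneg ht hv0), ?_, ?_⟩
  · filter_upwards [hcoe, huA, hvA] with z hz hu hv hzA
    rw [hz, hu hzA, hv hzA, mul_zero, mul_zero, add_zero]
  · rw [integral_congr_ae hcoe, integral_add ((L1.integrable_coeFn u).const_mul s)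
      ((L1.integrable_coeFn v).const_mul t), integral_const_mul, integral_const_mul, hua, hva,
      ← add_mul, hst, one_mul]

variable [IsFiniteMeasure m] {A : Set Z} {a t : ℝ} {γ : Lp ℝ ∞ m}

theorem uniform_mem_densitiesOn (ha : 0 ≤ a) {B : Set Z} (hB : MeasurableSet B) (hBA : B ⊆ A)
    (hmB : m B ≠ 0) :
    indicatorConstLp 1 hB (measure_ne_top m B) (a / m.real B) ∈ densitiesOn m A a := by
  have hcoe := indicatorConstLp_coeFn (p := 1) (hs := hB) (hμs := measure_ne_top m B)
    (c := a / m.real B)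
  refine ⟨?_, ?_, ?_⟩
  · rw [← Lp.coeFn_nonneg]
    filter_upwards [hcoe] with z hz
    rw [hz]
    exact indicator_nonneg (fun _ _ => by positivity) z
  · filter_upwards [hcoe] with z hz hzA
    rw [hz, indicator_of_notMem fun hzB => hzA (hBA hzB)]
  · rw [integral_indicatorConstLp, smul_eq_mul, mul_div_cancel₀]
    exact (measureReal_ne_zero_iff).2 hmB

theorem ae_mul_le_of_forall_densitiesOn (hA : MeasurableSet A) (ha : 0 ≤ a)
    (h : ∀ u ∈ densitiesOn m A a, ∫ z, u z * γ z ∂m ≤ t) :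
    ∀ᵐ z ∂m, z ∈ A → a * γ z ≤ t := by
  have hγ : Integrable γ m := (Lp.memLp γ).integrable le_top
  rw [← ae_restrict_iff' hA]
  refine ae_le_of_forall_setIntegral_le (hγ.const_mul a).restrict (integrable_const t)
    fun B hB _ => ?_
  rw [Measure.restrict_restrict hB, integral_const_mul, setIntegral_const, smul_eq_mul]
  rcases eq_or_ne (m (B ∩ A)) 0 with hzero | hne
  · simp [Measure.restrict_eq_zero.2 hzero, measureReal_def, hzero]
  · have hu := h _ (uniform_mem_densitiesOn ha (hB.inter hA) inter_subset_right hne)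
    have hint : ∫ z, indicatorConstLp 1 (hB.inter hA) (measure_ne_top m _)
        (a / m.real (B ∩ A)) z * γ z ∂m = a / m.real (B ∩ A) * ∫ z in B ∩ A, γ z ∂m := by
      rw [← integral_const_mul, ← integral_indicator (hB.inter hA)]
      refine integral_congr_ae ?_
      filter_upwards [indicatorConstLp_coeFn (p := 1) (hs := hB.inter hA)
        (hμs := measure_ne_top m _) (c := a / m.real (B ∩ A))] with z hz
      rw [hz, ← indicator_mul_left]
    have hpos : 0 < m.real (B ∩ A) := measureReal_nonneg.lt_of_ne' ((measureReal_ne_zero_iff).2 hne)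
    rwa [hint, div_mul_eq_mul_div, div_le_iff₀ hpos, mul_comm t] at hu

theorem DualLE.apply_le_of_forall_densitiesOn {σ : StrongDual ℝ (Lp ℝ ∞ m)} (hσ : DualLE 0 σ)
    (hA : MeasurableSet A) (hσA : VanishesOn σ Aᶜ)
    (h : ∀ u ∈ densitiesOn m A (σ (linftyOne m)), ∫ z, u z * γ z ∂m ≤ t) : σ γ ≤ t := by
  have hmass : 0 ≤ σ (linftyOne m) := hσ _ linftyOne_nonneg
  rcases hmass.eq_or_lt' with hzero | hpos
  · have hσ0 : σ = 0 := norm_eq_zero.1 (hσ.norm_eq.trans hzero)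
    have hmem : (0 : Lp ℝ 1 m) ∈ densitiesOn m A (σ (linftyOne m)) := by
      have hcoe := Lp.coeFn_zero ℝ 1 m
      refine ⟨le_rfl, hcoe.mono fun z hz _ => hz, ?_⟩
      rw [hzero, integral_congr_ae hcoe]
      simp
    have hint := h 0 hmem
    rw [hσ0]
    rwa [← regular_apply, map_zero, zero_apply] at hint
  · have hle : σ (σ (linftyOne m) • γ) ≤ σ (t • linftyOne m) := by
      refine hσ.le_of_le_on_compl hσA ?_
      filter_upwards [ae_mul_le_of_forall_densitiesOn hA hmass h, Lp.coeFn_smul t (linftyOne m),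
        Lp.coeFn_smul (σ (linftyOne m)) γ, coeFn_linftyOne (m := m)] with z hz ht hγ hone hzA
      rw [ht, hγ, Pi.smul_apply, Pi.smul_apply, hone, smul_eq_mul, smul_eq_mul, mul_one]
      exact hz (notMem_compl_iff.1 hzA)
    rw [map_smul, map_smul, smul_eq_mul, smul_eq_mul, mul_comm t] at hle
    exact le_of_mul_le_mul_left hle hpos

theorem DualLE.exists_norm_add_sub_lt {σ : StrongDual ℝ (Lp ℝ ∞ m)} (hσ : DualLE 0 σ)
    (hA : MeasurableSet A) (hσA : VanishesOn σ Aᶜ) {E : Submodule ℝ (Lp ℝ 1 m)} {r : Lp ℝ 1 m}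
    (hr : ∀ γ ∈ annihilator m E, regular m r γ = σ γ) {ε : ℝ} (hε : 0 < ε) :
    ∃ f ∈ E, ∃ u ∈ densitiesOn m A (σ (linftyOne m)), ‖f + u - r‖ < ε := by
  have hcl := mem_closure_add_submodule (convex_densitiesOn A (σ (linftyOne m))) (S := E) (r := r)
    fun ℓ t hE hU => by
      obtain ⟨γ, rfl⟩ := linftyToDual_surjective ℓ
      refine (hr γ (mem_annihilator.2 hE)).trans_le ?_
      exact hσ.apply_le_of_forall_densitiesOn hA hσA fun u hu => linftyToDual_apply γ u ▸ hU u hu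
  obtain ⟨_, ⟨u, hu, f, hf, rfl⟩, hdist⟩ := Metric.mem_closure_iff.1 hcl ε hε
  refine ⟨f, hf, u, hu, ?_⟩
  rwa [add_comm f u, ← dist_eq_norm, dist_comm]

end Approximation

section Escape

variable {Z : Type*} [MeasurableSpace Z] {m : Measure Z}

theorem escapeLim_le_escapeInf (F : ℕ → Z → ℝ) : escapeLim m F ≤ escapeInf m F := fun _ =>
  iSup_mono fun _ => iSup_mono fun _ => iSup_mono fun _ => iSup₂_le fun _ hl =>
    (EReal.tendsto_coe.2 hl).liminf_eq.ge

theorem escapeInf_le_escapeSup (F : ℕ → Z → ℝ) : escapeInf m F ≤ escapeSup m F := fun _ =>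
  iSup_mono fun _ => iSup_mono fun _ => iSup_mono fun _ => liminf_le_limsup

theorem tendsto_coe_ereal_of_eventually_le {ι : Type*} {l : Filter ι} {f : ι → EReal} {a : ℝ}
    (h : ∀ e : ℝ, 0 < e → ∀ᶠ i in l, ((a - e : ℝ) : EReal) ≤ f i ∧ f i ≤ ((a + e : ℝ) : EReal)) :
    Tendsto f l (𝓝 (a : EReal)) := by
  refine tendsto_order.2 ⟨fun b hb => ?_, fun b hb => ?_⟩
  · obtain ⟨x, hbx, hxa⟩ := EReal.lt_iff_exists_real_btwn.1 hb
    filter_upwards [h (a - x) (sub_pos.2 (EReal.coe_lt_coe_iff.1 hxa))] with i hi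
    exact hbx.trans_le (sub_sub_cancel a x ▸ hi.1)
  · obtain ⟨x, hax, hxb⟩ := EReal.lt_iff_exists_real_btwn.1 hb
    filter_upwards [h (x - a) (sub_pos.2 (EReal.coe_lt_coe_iff.1 hax))] with i hi
    exact (add_sub_cancel a x ▸ hi.2).trans_lt hxb

theorem eventually_abs_setIntegral_le {r : Z → ℝ} (hr : Integrable r m) {e : ℝ} (he : 0 < e) :
    ∀ᶠ δ in 𝓝[>] (0 : ℝ≥0∞), ∀ A, m A < δ → |∫ z in A, r z ∂m| ≤ e := by
  have hlim := (hr.tendsto_setIntegral_nhds_zero (s := id) tendsto_comap).abs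
  rw [abs_zero] at hlim
  obtain ⟨δ₀, hδ₀, h⟩ := ((ENNReal.nhds_zero_basis.comap m).eventually_iff).1
    (hlim.eventually_le_const he)
  filter_upwards [Ioo_mem_nhdsGT hδ₀] with δ hδ A hA using h (hA.trans hδ.2)

theorem ae_tendsto_zero_of_tsum_eLpNorm_one {f : ℕ → Z → ℝ}
    (hf : ∀ n, AEStronglyMeasurable (f n) m) (h : ∑' n, eLpNorm (f n) 1 m ≠ ∞) :
    ∀ᵐ z ∂m, Tendsto (fun n => f n z) atTop (𝓝 0) := by
  simp only [eLpNorm_one_eq_lintegral_enorm] at h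
  rw [← lintegral_tsum fun n => (hf n).enorm] at h
  filter_upwards [ae_lt_top' (AEMeasurable.tsum fun n => (hf n).enorm) h] with z hz
  exact tendsto_zero_iff_enorm_tendsto_zero.2 (ENNReal.tendsto_atTop_zero_of_tsum_ne_top hz.ne)

/-- The sequence `F` converges to `r` except that an amount `a` of its mass escapes to `-∞`: up to
summable errors in `L¹(m)`, `F n` is `r - u n` with `u n ≥ 0` of integral `a` carried by `B n`,
where `m (B n)` is summable. -/
structure IsEscapingApprox (m : Measure Z) (F u : ℕ → Z → ℝ) (r : Z → ℝ) (B : ℕ → Set Z)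
    (a : ℝ) : Prop where
  integrable : ∀ n, Integrable (F n) m
  integrable_limit : Integrable r m
  integrable_escaping : ∀ n, Integrable (u n) m
  escaping_nonneg : ∀ n, 0 ≤ᵐ[m] u n
  escaping_eq_zero : ∀ n, ∀ᵐ z ∂m, z ∉ B n → u n z = 0
  integral_escaping : ∀ n, ∫ z, u n z ∂m = a
  measurableSet : ∀ n, MeasurableSet (B n)
  tsum_measure_ne_top : ∑' n, m (B n) ≠ ∞
  tsum_eLpNorm_ne_top : ∑' n, eLpNorm (F n + u n - r) 1 m ≠ ∞

namespace IsEscapingApprox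

variable {F u : ℕ → Z → ℝ} {r : Z → ℝ} {B : ℕ → Set Z} {a : ℝ}

theorem congr {G : ℕ → Z → ℝ} (h : IsEscapingApprox m F u r B a) (hFG : ∀ n, F n =ᵐ[m] G n) :
    IsEscapingApprox m G u r B a :=
  { h with
    integrable := fun n => (h.integrable n).congr (hFG n)
    tsum_eLpNorm_ne_top := by
      refine ne_of_eq_of_ne (tsum_congr fun n => eLpNorm_congr_ae ?_) h.tsum_eLpNorm_ne_top
      exact ((hFG n).symm.add .rfl).sub .rfl }

theorem tendsto_eLpNorm (h : IsEscapingApprox m F u r B a) :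
    Tendsto (fun n => eLpNorm (F n + u n - r) 1 m) atTop (𝓝 0) :=
  ENNReal.tendsto_atTop_zero_of_tsum_ne_top h.tsum_eLpNorm_ne_top

theorem ae_tendsto (h : IsEscapingApprox m F u r B a) :
    ∀ᵐ z ∂m, Tendsto (fun n => F n z) atTop (𝓝 (r z)) := by
  filter_upwards [ae_tendsto_zero_of_tsum_eLpNorm_one (fun n => (((h.integrable n).add
      (h.integrable_escaping n)).sub h.integrable_limit).aestronglyMeasurable)
      h.tsum_eLpNorm_ne_top,
    ae_eventually_notMem h.tsum_measure_ne_top, ae_all_iff.2 h.escaping_eq_zero]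
    with z hlim hB hu
  refine tendsto_sub_nhds_zero_iff.1 (hlim.congr' ?_)
  filter_upwards [hB] with n hn
  simp [hu n hn]

theorem tendsto_eLpNorm_max (h : IsEscapingApprox m F u r B a) :
    Tendsto (fun n => eLpNorm (fun z => max (F n z - r z) 0) 1 m) atTop (𝓝 0) := by
  refine tendsto_of_tendsto_of_tendsto_of_le_of_le tendsto_const_nhds h.tendsto_eLpNorm
    (fun _ => zero_le) fun n => eLpNorm_mono_ae ?_
  filter_upwards [h.escaping_nonneg n] with z (hz : 0 ≤ u n z)
  rw [Real.norm_of_nonneg (le_max_right _ _), Real.norm_eq_abs]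
  refine max_le (le_trans ?_ (le_abs_self _)) (abs_nonneg _)
  simpa only [Pi.sub_apply, Pi.add_apply, sub_le_sub_iff_right, le_add_iff_nonneg_right] using hz

theorem tendsto_setIntegral_add (h : IsEscapingApprox m F u r B a) (A : Set Z) :
    Tendsto (fun n => ∫ z in A, F n z ∂m + ∫ z in A, u n z ∂m) atTop (𝓝 (∫ z in A, r z ∂m)) := by
  refine (tendsto_setIntegral_of_L1' r h.integrable_limit.aestronglyMeasurable
    (Eventually.of_forall fun n => (h.integrable n).add (h.integrable_escaping n))
    h.tendsto_eLpNorm A).congr fun n => ?_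
  exact integral_add (h.integrable n).integrableOn (h.integrable_escaping n).integrableOn

theorem tendsto_setIntegral_iUnion (h : IsEscapingApprox m F u r B a) (N : ℕ) :
    Tendsto (fun n => -∫ z in ⋃ j, B (j + N), F n z ∂m) atTop
      (𝓝 (a - ∫ z in ⋃ j, B (j + N), r z ∂m)) := by
  refine ((h.tendsto_setIntegral_add _).const_sub a).congr' ?_
  filter_upwards [eventually_ge_atTop N] with n hn
  have hmass : ∫ z in ⋃ j, B (j + N), u n z ∂m = a := by
    rw [← h.integral_escaping n]
    refine setIntegral_eq_integral_of_ae_compl_eq_zero ?_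
    filter_upwards [h.escaping_eq_zero n] with z hz hzB
    exact hz fun hzn => hzB (mem_iUnion.2 ⟨n - N, by rwa [Nat.sub_add_cancel hn]⟩)
  rw [hmass]
  ring

theorem le_escapeLim (h : IsEscapingApprox m F u r B a) {e : ℝ} {δ : ℝ≥0∞} (hδ : 0 < δ)
    (hr : ∀ A, m A < δ → |∫ z in A, r z ∂m| ≤ e) :
    ((a - e : ℝ) : EReal) ≤ escapeLim m F δ := by
  obtain ⟨N, hN⟩ := ((ENNReal.tendsto_sum_nat_add (fun n => m (B n))
    h.tsum_measure_ne_top).eventually_lt_const hδ).exists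
  have hmA : m (⋃ j, B (j + N)) < δ := (measure_iUnion_le _).trans_lt hN
  calc ((a - e : ℝ) : EReal) ≤ ((a - ∫ z in ⋃ j, B (j + N), r z ∂m : ℝ) : EReal) :=
        EReal.coe_le_coe_iff.2 (sub_le_sub_left (le_of_abs_le (hr _ hmA)) a)
    _ ≤ escapeLim m F δ :=
        le_iSup₂_of_le _ (.iUnion fun _ => h.measurableSet _) <|
          le_iSup₂_of_le hmA _ <| le_iSup_of_le (h.tendsto_setIntegral_iUnion N) le_rfl

theorem escapeSup_le (h : IsEscapingApprox m F u r B a) {e : ℝ} {δ : ℝ≥0∞}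
    (hr : ∀ A, m A < δ → |∫ z in A, r z ∂m| ≤ e) :
    escapeSup m F δ ≤ ((a + e : ℝ) : EReal) := by
  refine iSup₂_le fun A _ => iSup_le fun hmA => ?_
  have hle (n : ℕ) : -∫ z in A, F n z ∂m ≤ a - (∫ z in A, F n z ∂m + ∫ z in A, u n z ∂m) := by
    have hu := setIntegral_le_integral (s := A) (h.integrable_escaping n) (h.escaping_nonneg n)
    rw [h.integral_escaping n] at hu
    linarith
  calc limsup (fun n => ((-∫ z in A, F n z ∂m : ℝ) : EReal)) atTop
      ≤ limsup (fun n => ((a - (∫ z in A, F n z ∂m + ∫ z in A, u n z ∂m) : ℝ) : EReal)) atTop :=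
        limsup_le_limsup (Eventually.of_forall fun n => EReal.coe_le_coe_iff.2 (hle n))
    _ = ((a - ∫ z in A, r z ∂m : ℝ) : EReal) :=
        (EReal.tendsto_coe.2 ((h.tendsto_setIntegral_add A).const_sub a)).limsup_eq
    _ ≤ ((a + e : ℝ) : EReal) :=
        EReal.coe_le_coe_iff.2 (by linarith [neg_le_of_abs_le (hr A hmA)])

theorem tendsto_escape (h : IsEscapingApprox m F u r B a) {f : ℝ≥0∞ → EReal}
    (hl : escapeLim m F ≤ f) (hs : f ≤ escapeSup m F) :
    Tendsto f (𝓝[>] 0) (𝓝 (a : EReal)) := by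
  refine tendsto_coe_ereal_of_eventually_le fun e he => ?_
  filter_upwards [eventually_abs_setIntegral_le h.integrable_limit he, self_mem_nhdsWithin]
    with δ hr hδ
  exact ⟨(h.le_escapeLim hδ hr).trans (hl δ), (hs δ).trans (h.escapeSup_le hr)⟩

end IsEscapingApprox

theorem exists_isEscapingApprox [IsFiniteMeasure m] {σ : StrongDual ℝ (Lp ℝ ∞ m)}
    (hσ : DualLE 0 σ) (hps : PurelySingular σ) {E : Submodule ℝ (Lp ℝ 1 m)} {r : Lp ℝ 1 m}
    (hr : ∀ γ ∈ annihilator m E, regular m r γ = σ γ) :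
    ∃ f u : ℕ → Lp ℝ 1 m, ∃ B, (∀ n, f n ∈ E) ∧
      IsEscapingApprox m (fun n => f n) (fun n => u n) r B (σ (linftyOne m)) := by
  obtain ⟨A, hA, -, hA0, hσA⟩ := hps
  obtain ⟨ε, hε, hsum⟩ := ENNReal.exists_pos_sum_of_countable one_ne_zero ℕ
  choose k hk using fun n => (hA0.eventually_le_const (ENNReal.coe_pos.2 (hε n))).exists
  choose f hfE u hu hfu using fun n =>
    hσ.exists_norm_add_sub_lt (hA (k n)) (hσA (k n)) hr (NNReal.coe_pos.2 (hε n))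
  have hdist (n : ℕ) : eLpNorm (⇑(f n) + ⇑(u n) - ⇑r) 1 m ≤ ε n := by
    rw [eLpNorm_congr_ae (((Lp.coeFn_add _ _).symm.sub .rfl).trans (Lp.coeFn_sub _ _).symm),
      ← Lp.enorm_def, ← ofReal_norm, ← ENNReal.ofReal_coe_nnreal]
    exact ENNReal.ofReal_le_ofReal (hfu n).le
  exact ⟨f, u, fun n => A (k n), hfE,
    { integrable := fun n => L1.integrable_coeFn (f n)
      integrable_limit := L1.integrable_coeFn r
      integrable_escaping := fun n => L1.integrable_coeFn (u n)
      escaping_nonneg := fun n => (Lp.coeFn_nonneg _).2 (hu n).1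
      escaping_eq_zero := fun n => (hu n).2.1
      integral_escaping := fun n => (hu n).2.2
      measurableSet := fun n => hA (k n)
      tsum_measure_ne_top := ((ENNReal.tsum_le_tsum hk).trans_lt hsum).ne_top
      tsum_eLpNorm_ne_top := ((ENNReal.tsum_le_tsum hdist).trans_lt hsum).ne_top }⟩

end Escape

section Plans

variable {X Y : Type*} [MeasurableSpace X] [MeasurableSpace Y] {μ : Measure X} {ν : Measure Y}
  {π₀ π : Measure (X × Y)} {φ : X → ℝ} {ψ : Y → ℝ} {γ : Lp ℝ ∞ π₀}

theorem isProbabilityMeasure_fst (hπ : π ∈ transportPlans μ ν) : IsProbabilityMeasure μ := by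
  obtain ⟨_, rfl, -⟩ := hπ
  infer_instance

theorem isProbabilityMeasure_snd (hπ : π ∈ transportPlans μ ν) : IsProbabilityMeasure ν := by
  obtain ⟨_, -, rfl⟩ := hπ
  infer_instance

theorem integrable_oplus (hπ : π ∈ transportPlans μ ν) (hφ : Integrable φ μ)
    (hψ : Integrable ψ ν) : Integrable (oplus φ ψ) π := by
  obtain ⟨-, rfl, rfl⟩ := hπ
  exact (hφ.comp_measurable measurable_fst).add (hψ.comp_measurable measurable_snd)

theorem integral_oplus (hπ : π ∈ transportPlans μ ν) (hφ : Integrable φ μ)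
    (hψ : Integrable ψ ν) : ∫ z, oplus φ ψ z ∂π = ∫ x, φ x ∂μ + ∫ y, ψ y ∂ν := by
  obtain ⟨-, rfl, rfl⟩ := hπ
  rw [Measure.fst, Measure.snd, integral_map measurable_fst.aemeasurable hφ.aestronglyMeasurable,
    integral_map measurable_snd.aemeasurable hψ.aestronglyMeasurable]
  exact integral_add (hφ.comp_measurable measurable_fst) (hψ.comp_measurable measurable_snd)

theorem mem_transportPlans_of_integral_oplus [IsProbabilityMeasure μ] [IsFiniteMeasure ν]
    [IsFiniteMeasure π] (h : ∀ (φ : X → ℝ) (ψ : Y → ℝ), Integrable φ μ → Integrable ψ ν →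
      ∫ z, oplus φ ψ z ∂π = ∫ x, φ x ∂μ + ∫ y, ψ y ∂ν) : π ∈ transportPlans μ ν := by
  have hfst : π.fst = μ := by
    ext A hA
    have hone : ((Prod.fst ⁻¹' A).indicator 1 : X × Y → ℝ) = oplus (A.indicator 1) 0 :=
      funext fun _ => (add_zero _).symm
    rw [Measure.fst_apply hA, ← measureReal_eq_measureReal_iff,
      ← integral_indicator_one (measurable_fst hA), ← integral_indicator_one hA, hone,
      h (A.indicator 1) _ ((integrable_const 1).indicator hA) (integrable_zero _ _ _),
      integral_zero', add_zero]
  have hsnd : π.snd = ν := by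
    ext A hA
    have hone : ((Prod.snd ⁻¹' A).indicator 1 : X × Y → ℝ) = oplus 0 (A.indicator 1) :=
      funext fun _ => (zero_add _).symm
    rw [Measure.snd_apply hA, ← measureReal_eq_measureReal_iff,
      ← integral_indicator_one (measurable_snd hA), ← integral_indicator_one hA, hone,
      h _ (A.indicator 1) (integrable_zero _ _ _) ((integrable_const 1).indicator hA),
      integral_zero', zero_add]
  exact ⟨⟨by rw [← Measure.fst_univ, hfst, measure_univ]⟩, hfst, hsnd⟩

/-- The linear subspace of `L¹(π₀)` whose closure is `L¹_S(π₀)`: the functions `φ ⊕ ψ` form a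
subspace, so no linear span is taken. -/
def oplusSubmodule (μ : Measure X) (ν : Measure Y) (π₀ : Measure (X × Y)) :
    Submodule ℝ (Lp ℝ 1 π₀) where
  carrier := {f | ∃ (φ : X → ℝ) (ψ : Y → ℝ),
    Integrable φ μ ∧ Integrable ψ ν ∧ f =ᵐ[π₀] oplus φ ψ}
  zero_mem' := by
    refine ⟨0, 0, integrable_zero _ _ _, integrable_zero _ _ _, ?_⟩
    filter_upwards [Lp.coeFn_zero ℝ 1 π₀] with z hz
    exact hz.trans (add_zero 0).symm
  add_mem' := by
    rintro f g ⟨φ, ψ, hφ, hψ, hf⟩ ⟨φ', ψ', hφ', hψ', hg⟩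
    refine ⟨φ + φ', ψ + ψ', hφ.add hφ', hψ.add hψ', ?_⟩
    filter_upwards [Lp.coeFn_add f g, hf, hg] with z hadd hfz hgz
    simp only [hadd, hfz, hgz, oplus, Pi.add_apply]
    ring
  smul_mem' := by
    rintro a f ⟨φ, ψ, hφ, hψ, hf⟩
    refine ⟨a • φ, a • ψ, hφ.smul a, hψ.smul a, ?_⟩
    filter_upwards [Lp.coeFn_smul a f, hf] with z hsmul hfz
    simp only [hsmul, hfz, oplus, Pi.smul_apply, smul_add]

theorem L1S_eq_topologicalClosure :
    L1S μ ν π₀ = (oplusSubmodule μ ν π₀).topologicalClosure :=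
  congrArg _ (oplusSubmodule μ ν π₀).span_eq

theorem annihilator_L1S : annihilator π₀ (L1S μ ν π₀) = annihilator π₀ (oplusSubmodule μ ν π₀) := by
  rw [L1S_eq_topologicalClosure, annihilator_topologicalClosure]

theorem const_one_mem_L1S (hπ₀ : π₀ ∈ transportPlans μ ν) [IsFiniteMeasure π₀] :
    Lp.const 1 π₀ (1 : ℝ) ∈ L1S μ ν π₀ := by
  have := isProbabilityMeasure_fst hπ₀
  rw [L1S_eq_topologicalClosure]
  refine Submodule.le_topologicalClosure _
    ⟨1, 0, integrable_const 1, integrable_zero _ _ _, ?_⟩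
  filter_upwards [Lp.coeFn_const 1 π₀ (1 : ℝ)] with z hz
  exact hz.trans (add_zero 1).symm

theorem mem_annihilator_L1S (hπ₀ : π₀ ∈ transportPlans μ ν) :
    γ ∈ annihilator π₀ (L1S μ ν π₀) ↔ ∀ (φ : X → ℝ) (ψ : Y → ℝ),
      Integrable φ μ → Integrable ψ ν → ∫ z, oplus φ ψ z * γ z ∂π₀ = 0 := by
  rw [annihilator_L1S, mem_annihilator]
  refine ⟨fun h φ ψ hφ hψ => ?_, ?_⟩
  · have hmem := memLp_one_iff_integrable.2 (integrable_oplus hπ₀ hφ hψ)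
    rw [← h (hmem.toLp _) ⟨φ, ψ, hφ, hψ, hmem.coeFn_toLp⟩, regular_apply]
    exact integral_congr_ae (hmem.coeFn_toLp.symm.mul .rfl)
  · rintro h f ⟨φ, ψ, hφ, hψ, hf⟩
    rw [regular_apply, ← h φ ψ hφ hψ]
    exact integral_congr_ae (hf.mul .rfl)

theorem sub_linftyOne_mem_annihilator_L1S [IsFiniteMeasure π₀] (hπ₀ : π₀ ∈ transportPlans μ ν) :
    γ - linftyOne π₀ ∈ annihilator π₀ (L1S μ ν π₀) ↔ ∀ (φ : X → ℝ) (ψ : Y → ℝ),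
      Integrable φ μ → Integrable ψ ν →
        ∫ z, oplus φ ψ z * γ z ∂π₀ = ∫ x, φ x ∂μ + ∫ y, ψ y ∂ν := by
  rw [mem_annihilator_L1S hπ₀]
  refine forall₄_congr fun φ ψ hφ hψ => ?_
  have hI := integrable_oplus hπ₀ hφ hψ
  rw [← integral_oplus hπ₀ hφ hψ, ← sub_eq_zero (b := ∫ z, oplus φ ψ z ∂π₀),
    ← integral_sub (integrable_mul_linfty hI γ) hI]
  refine Eq.congr_left (integral_congr_ae ?_)
  filter_upwards [Lp.coeFn_sub γ (linftyOne π₀), coeFn_linftyOne (m := π₀)] with z hsub hone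
  rw [hsub, Pi.sub_apply, hone, mul_sub, mul_one]

end Plans

section Density

variable {X Y : Type*} [MeasurableSpace X] [MeasurableSpace Y] {μ : Measure X} {ν : Measure Y}
  {π₀ π : Measure (X × Y)} {γ : Lp ℝ ∞ π₀}

theorem coeFn_density (hπ : π ∈ boundedPlans μ ν π₀) :
    density hπ =ᵐ[π₀] fun z => (π.rnDeriv π₀ z).toReal :=
  MemLp.coeFn_toLp _

theorem density_nonneg (hπ : π ∈ boundedPlans μ ν π₀) : 0 ≤ density hπ := by
  rw [← Lp.coeFn_nonneg]
  filter_upwards [coeFn_density hπ] with z hz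
  exact hz ▸ ENNReal.toReal_nonneg

theorem integral_mul_density [SigmaFinite π₀] (hπ : π ∈ boundedPlans μ ν π₀)
    (f : X × Y → ℝ) : ∫ z, f z * density hπ z ∂π₀ = ∫ z, f z ∂π := by
  have := hπ.1.1
  rw [← integral_toReal_rnDeriv_mul hπ.2.1]
  refine integral_congr_ae ?_
  filter_upwards [coeFn_density hπ] with z hz
  rw [hz, mul_comm]

theorem density_sub_linftyOne_mem_annihilator [IsFiniteMeasure π₀]
    (hπ₀ : π₀ ∈ transportPlans μ ν) (hπ : π ∈ boundedPlans μ ν π₀) :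
    density hπ - linftyOne π₀ ∈ annihilator π₀ (L1S μ ν π₀) :=
  (sub_linftyOne_mem_annihilator_L1S hπ₀).2 fun φ ψ hφ hψ => by
    rw [integral_mul_density, integral_oplus hπ.1 hφ hψ]

theorem bidualEmb_density [IsFiniteMeasure π₀] (hπ₀ : π₀ ∈ transportPlans μ ν)
    (hπ : π ∈ boundedPlans μ ν π₀) (h : StrongDual ℝ (StrongDual ℝ (L1S μ ν π₀))) :
    bidualEmb π₀ (L1S μ ν π₀) h (density hπ) = bidualEmb π₀ (L1S μ ν π₀) h (linftyOne π₀) := by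
  rw [← sub_eq_zero, ← map_sub]
  exact bidualEmb_eq_zero h (density_sub_linftyOne_mem_annihilator hπ₀ hπ)

theorem integral_withDensity_linfty (hγ : 0 ≤ γ) (f : X × Y → ℝ) :
    ∫ z, f z ∂π₀.withDensity (fun z => ENNReal.ofReal (γ z)) = ∫ z, f z * γ z ∂π₀ := by
  rw [integral_withDensity_eq_integral_toReal_smul
    (Lp.stronglyMeasurable γ).measurable.ennreal_ofReal
    (ae_of_all _ fun _ => ENNReal.ofReal_lt_top)]
  refine integral_congr_ae ?_
  filter_upwards [(Lp.coeFn_nonneg γ).2 hγ] with z hz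
  rw [ENNReal.toReal_ofReal hz, smul_eq_mul, mul_comm]

theorem withDensity_mem_boundedPlans [IsFiniteMeasure π₀] (hπ₀ : π₀ ∈ transportPlans μ ν)
    (hγ : 0 ≤ γ) (hmem : γ - linftyOne π₀ ∈ annihilator π₀ (L1S μ ν π₀)) :
    π₀.withDensity (fun z => ENNReal.ofReal (γ z)) ∈ boundedPlans μ ν π₀ := by
  have := isProbabilityMeasure_fst hπ₀
  have := isProbabilityMeasure_snd hπ₀
  have := isFiniteMeasure_withDensity_ofReal ((Lp.memLp γ).integrable le_top).hasFiniteIntegral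
  refine ⟨mem_transportPlans_of_integral_oplus fun φ ψ hφ hψ => ?_,
    withDensity_absolutelyContinuous _ _, ?_⟩
  · rw [integral_withDensity_linfty hγ]
    exact (sub_linftyOne_mem_annihilator_L1S hπ₀).1 hmem φ ψ hφ hψ
  · refine (essSup_le_of_ae_le (ENNReal.ofReal ‖γ‖) ?_).trans_lt ENNReal.ofReal_lt_top
    filter_upwards [Measure.rnDeriv_withDensity π₀
      (Lp.stronglyMeasurable γ).measurable.ennreal_ofReal, ae_abs_le_norm γ] with z hz hle
    exact hz ▸ ENNReal.ofReal_le_ofReal (le_of_abs_le hle)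

end Density

section Duality

variable {X Y : Type*} [MeasurableSpace X] [MeasurableSpace Y] {μ : Measure X} {ν : Measure Y}
  {c : X × Y → ℝ≥0∞} {π₀ π : Measure (X × Y)} {γ : Lp ℝ ∞ π₀}

theorem coeFn_costClass (hc : Measurable c) (hπ₀ : π₀ ∈ finitePlans μ ν c) :
    costClass hc hπ₀ =ᵐ[π₀] fun z => (c z).toReal :=
  MemLp.coeFn_toLp _

theorem ae_cost_lt_top (hc : Measurable c) (hπ₀ : π₀ ∈ finitePlans μ ν c) :
    ∀ᵐ z ∂π₀, c z < ∞ :=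
  ae_lt_top hc hπ₀.2.ne

theorem ae_coe_le_cost (hc : Measurable c) (hπ₀ : π₀ ∈ finitePlans μ ν c) {r : Lp ℝ 1 π₀}
    (hr : r ≤ costClass hc hπ₀) : ∀ᵐ z ∂π₀, ((r z : ℝ) : EReal) ≤ (c z : EReal) := by
  filter_upwards [(Lp.coeFn_le _ _).2 hr, coeFn_costClass hc hπ₀, ae_cost_lt_top hc hπ₀]
    with z hle hcost hfin
  rw [← EReal.coe_ennreal_toReal hfin.ne, EReal.coe_le_coe_iff, ← hcost]
  exact hle

theorem regular_costClass (hc : Measurable c) (hπ₀ : π₀ ∈ finitePlans μ ν c) (hγ : 0 ≤ γ) :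
    regular π₀ (costClass hc hπ₀) γ =
      (∫⁻ z, c z ∂π₀.withDensity fun z => ENNReal.ofReal (γ z)).toReal := by
  rw [regular_apply, ← integral_withDensity_linfty hγ, ← integral_toReal hc.aemeasurable]
  · exact integral_congr_ae ((withDensity_absolutelyContinuous _ _).ae_le (coeFn_costClass hc hπ₀))
  · exact (withDensity_absolutelyContinuous _ _).ae_le (ae_cost_lt_top hc hπ₀)

theorem withDensity_density [SigmaFinite π₀] (hπ : π ∈ boundedPlans μ ν π₀) :
    (π₀.withDensity fun z => ENNReal.ofReal (density hπ z)) = π := by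
  have := hπ.1.1
  conv_rhs => rw [← Measure.withDensity_rnDeriv_eq π π₀ hπ.2.1]
  refine withDensity_congr_ae ?_
  filter_upwards [coeFn_density hπ, Measure.rnDeriv_lt_top π π₀] with z hz hlt
  rw [hz, ENNReal.ofReal_toReal hlt.ne]

theorem regular_costClass_density (hc : Measurable c)
    (hπ₀ : π₀ ∈ finitePlans μ ν c) (hπ : π ∈ boundedPlans μ ν π₀) :
    regular π₀ (costClass hc hπ₀) (density hπ) = (∫⁻ z, c z ∂π).toReal := by
  have := hπ₀.1.1
  rw [regular_costClass hc hπ₀ (density_nonneg hπ), withDensity_density hπ]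

theorem lintegral_cost_withDensity_ne_top (hπ₀ : π₀ ∈ finitePlans μ ν c) :
    ∫⁻ z, c z ∂π₀.withDensity (fun z => ENNReal.ofReal (γ z)) ≠ ∞ := by
  have hle : π₀.withDensity (fun z => ENNReal.ofReal (γ z)) ≤ ENNReal.ofReal ‖γ‖ • π₀ := by
    rw [← withDensity_const]
    refine withDensity_mono ?_
    filter_upwards [ae_abs_le_norm γ] with z hz
    exact ENNReal.ofReal_le_ofReal (le_of_abs_le hz)
  refine ne_top_of_le_ne_top ?_ (lintegral_mono' hle le_rfl)
  rw [lintegral_smul_measure]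
  exact ENNReal.mul_ne_top ENNReal.ofReal_ne_top hπ₀.2.ne

theorem primalValue_ne_top (hπ₀ : π₀ ∈ finitePlans μ ν c) : primalValue μ ν c π₀ ≠ ∞ :=
  ((iInf₂_le π₀ (mem_boundedPlans_self hπ₀)).trans_lt hπ₀.2).ne

theorem primalValue_toReal_le [IsFiniteMeasure π₀] (hc : Measurable c)
    (hπ₀ : π₀ ∈ finitePlans μ ν c) (hγ : 0 ≤ γ)
    (hmem : γ - linftyOne π₀ ∈ annihilator π₀ (L1S μ ν π₀)) :
    (primalValue μ ν c π₀).toReal ≤ regular π₀ (costClass hc hπ₀) γ := by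
  rw [regular_costClass hc hπ₀ hγ]
  exact ENNReal.toReal_mono (lintegral_cost_withDensity_ne_top hπ₀)
    (iInf₂_le _ (withDensity_mem_boundedPlans hπ₀.1 hγ hmem))

theorem sub_toReal_le_toReal_ofReal_sub (a : ℝ) {b : ℝ≥0∞} (hb : b ≠ ∞) :
    a - b.toReal ≤ (ENNReal.ofReal a - b).toReal :=
  (sub_le_sub_right ((le_max_left a 0).trans_eq ENNReal.toReal_ofReal'.symm) _).trans
    (ENNReal.le_toReal_sub hb)

theorem integral_oplus_le_of_lintegral_sub_le (hc : Measurable c)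
    (hπ₀ : π₀ ∈ finitePlans μ ν c) (hπ : π ∈ boundedPlans μ ν π₀) {φ : X → ℝ} {ψ : Y → ℝ}
    (hφ : Integrable φ μ) (hψ : Integrable ψ ν) {ε : ℝ} (hε : 0 ≤ ε)
    (hle : ∫⁻ z, (ENNReal.ofReal (oplus φ ψ z) - c z) ∂π₀ ≤ ENNReal.ofReal ε) :
    ∫ x, φ x ∂μ + ∫ y, ψ y ∂ν ≤ (∫⁻ z, c z ∂π).toReal + ‖density hπ‖ * ε := by
  have := hπ₀.1.1
  set e : X × Y → ℝ≥0∞ := fun z => ENNReal.ofReal (oplus φ ψ z) - c z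
  have hI := integrable_oplus hπ₀.1 hφ hψ
  have hcI : Integrable (costClass hc hπ₀) π₀ := L1.integrable_coeFn _
  have heM : AEMeasurable e π₀ := hI.aemeasurable.ennreal_ofReal.sub hc.aemeasurable
  have hefin := (hle.trans_lt ENNReal.ofReal_lt_top).ne
  have heI := integrable_toReal_of_lintegral_ne_top heM hefin
  have he : ∫ z, (e z).toReal ∂π₀ ≤ ε := by
    rw [integral_toReal heM (ae_lt_top' heM hefin)]
    exact ENNReal.toReal_le_of_le_ofReal hε hle
  rw [← integral_oplus hπ.1 hφ hψ, ← integral_mul_density hπ,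
    ← regular_costClass_density hc hπ₀ hπ, regular_apply]
  calc ∫ z, oplus φ ψ z * density hπ z ∂π₀
      ≤ ∫ z, (costClass hc hπ₀ z * density hπ z + ‖density hπ‖ * (e z).toReal) ∂π₀ := by
        refine integral_mono_ae (integrable_mul_linfty hI _)
          ((integrable_mul_linfty hcI _).add (heI.const_mul _)) ?_
        filter_upwards [ae_cost_lt_top hc hπ₀, coeFn_costClass hc hπ₀,
          ae_abs_le_norm (density hπ), (Lp.coeFn_nonneg _).2 (density_nonneg hπ)]
          with z hfin hcost hnorm (hpos : 0 ≤ density hπ z)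
        rw [hcost, ← sub_le_iff_le_add', ← sub_mul, mul_comm ‖density hπ‖]
        exact mul_le_mul (sub_toReal_le_toReal_ofReal_sub _ hfin.ne) (le_of_abs_le hnorm) hpos
          ENNReal.toReal_nonneg
    _ = ∫ z, costClass hc hπ₀ z * density hπ z ∂π₀ + ‖density hπ‖ * ∫ z, (e z).toReal ∂π₀ := by
        rw [integral_add (integrable_mul_linfty hcI _) (heI.const_mul _), integral_const_mul]
    _ ≤ _ := by gcongr

theorem relaxedDualValue_le (hc : Measurable c)
    (hπ₀ : π₀ ∈ finitePlans μ ν c) (hπ : π ∈ boundedPlans μ ν π₀) {ε : ℝ} (hε : 0 ≤ ε) :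
    relaxedDualValue μ ν c π₀ ε ≤ (((∫⁻ z, c z ∂π).toReal + ‖density hπ‖ * ε : ℝ) : EReal) := by
  refine sSup_le ?_
  rintro _ ⟨φ, ψ, hφ, hψ, hle, rfl⟩
  exact EReal.coe_le_coe_iff.2 (integral_oplus_le_of_lintegral_sub_le hc hπ₀ hπ hφ hψ hε hle)

theorem le_relaxedDualValue {φ : ℕ → X → ℝ} {ψ : ℕ → Y → ℝ} (hφ : ∀ n, Integrable (φ n) μ)
    (hψ : ∀ n, Integrable (ψ n) ν) {r : X × Y → ℝ}
    (hr : ∀ᵐ z ∂π₀, ((r z : ℝ) : EReal) ≤ (c z : EReal))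
    (hpos : Tendsto (fun n => eLpNorm (fun z => max (oplus (φ n) (ψ n) z - r z) 0) 1 π₀)
      atTop (𝓝 0)) {P : ℝ}
    (hP : Tendsto (fun n => ∫ x, φ n x ∂μ + ∫ y, ψ n y ∂ν) atTop (𝓝 P)) {ε : ℝ} (hε : 0 < ε) :
    (P : EReal) ≤ relaxedDualValue μ ν c π₀ ε := by
  refine le_of_tendsto (EReal.tendsto_coe.2 hP) ?_
  filter_upwards [hpos.eventually_le_const (ENNReal.ofReal_pos.2 hε)] with n hn
  refine le_sSup ⟨φ n, ψ n, hφ n, hψ n, le_trans ?_ hn, rfl⟩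
  rw [eLpNorm_one_eq_lintegral_enorm]
  refine lintegral_mono_ae ?_
  filter_upwards [hr] with z hz
  have hrc : ENNReal.ofReal (r z) ≤ c z := by
    simpa only [EReal.toENNReal_of_ne_top (EReal.coe_ne_top _), EReal.toReal_coe,
      EReal.toENNReal_coe] using EReal.toENNReal_le_toENNReal hz
  rw [tsub_le_iff_right, Real.enorm_of_nonneg (le_max_right _ _)]
  calc ENNReal.ofReal (oplus (φ n) (ψ n) z)
      ≤ ENNReal.ofReal (max (oplus (φ n) (ψ n) z - r z) 0 + r z) :=
        ENNReal.ofReal_le_ofReal (sub_le_iff_le_add.1 (le_max_left _ _))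
    _ ≤ ENNReal.ofReal (max (oplus (φ n) (ψ n) z - r z) 0) + ENNReal.ofReal (r z) :=
        ENNReal.ofReal_add_le
    _ ≤ _ := by gcongr

theorem eventually_relaxedDualValue_lt (hc : Measurable c)
    (hπ₀ : π₀ ∈ finitePlans μ ν c) {b : EReal} (hb : (primalValue μ ν c π₀ : EReal) < b) :
    ∀ᶠ ε in 𝓝[>] (0 : ℝ), relaxedDualValue μ ν c π₀ ε < b := by
  obtain ⟨x, hPx, hxb⟩ := EReal.lt_iff_exists_real_btwn.1 hb
  rw [← EReal.coe_ennreal_toReal (primalValue_ne_top hπ₀), EReal.coe_lt_coe_iff,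
    ← ENNReal.lt_ofReal_iff_toReal_lt (primalValue_ne_top hπ₀)] at hPx
  simp only [primalValue, iInf_lt_iff] at hPx
  obtain ⟨π, hπ, hlt⟩ := hPx
  have hlim : Tendsto (fun ε => (∫⁻ z, c z ∂π).toReal + ‖density hπ‖ * ε) (𝓝[>] 0)
      (𝓝 ((∫⁻ z, c z ∂π).toReal + ‖density hπ‖ * 0)) :=
    Tendsto.mono_left (Continuous.tendsto (by fun_prop) 0) nhdsWithin_le_nhds
  rw [mul_zero, add_zero] at hlim
  filter_upwards [hlim.eventually_lt_const (ENNReal.toReal_lt_of_lt_ofReal hlt),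
    self_mem_nhdsWithin] with ε hεx hε
  exact (relaxedDualValue_le hc hπ₀ hπ (le_of_lt hε)).trans_lt
    ((EReal.coe_lt_coe_iff.2 hεx).trans hxb)

theorem tendsto_relaxedDualValue (hc : Measurable c)
    (hπ₀ : π₀ ∈ finitePlans μ ν c)
    (h : ∀ ε : ℝ, 0 < ε → (primalValue μ ν c π₀ : EReal) ≤ relaxedDualValue μ ν c π₀ ε) :
    Tendsto (relaxedDualValue μ ν c π₀) (𝓝[>] 0) (𝓝 (primalValue μ ν c π₀ : EReal)) := by
  refine tendsto_order.2 ⟨fun b hb => ?_, fun b hb => eventually_relaxedDualValue_lt hc hπ₀ hb⟩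
  filter_upwards [self_mem_nhdsWithin] with ε hε using hb.trans_le (h ε hε)

end Duality

section DualOptimizer

variable {X Y : Type*} [MeasurableSpace X] [MeasurableSpace Y] {μ : Measure X} {ν : Measure Y}
  {c : X × Y → ℝ≥0∞} {π₀ π : Measure (X × Y)} {h : StrongDual ℝ (StrongDual ℝ (L1S μ ν π₀))}
  {hr : Lp ℝ 1 π₀} {hs : StrongDual ℝ (Lp ℝ ∞ π₀)}

theorem vanishesOn_lt_rnDeriv (hs0 : DualLE hs 0) (hπ : π ∈ boundedPlans μ ν π₀)
    (hzero : hs (density hπ) = 0) {ε : ℝ≥0∞} (hε : 0 < ε) :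
    VanishesOn hs {z | ε < π.rnDeriv π₀ z} := by
  have := hπ.1.1
  have hmin : min ε 1 ≠ ∞ := ne_top_of_le_ne_top ENNReal.one_ne_top (min_le_right ε 1)
  have hpos : 0 < (min ε 1).toReal := ENNReal.toReal_pos (lt_min hε one_pos).ne' hmin
  rw [← neg_neg hs]
  refine (hs0.zero_le_neg.vanishesOn (density_nonneg hπ) ?_ hpos ?_).neg
  · rw [neg_apply, hzero, neg_zero]
  · filter_upwards [coeFn_density hπ, Measure.rnDeriv_lt_top π π₀] with z hz hfin hzε
    rw [hz]
    exact ENNReal.toReal_mono hfin.ne ((min_le_left _ _).trans (le_of_lt hzε))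

variable [IsFiniteMeasure π₀]

theorem exists_bidual_le_costClass (hc : Measurable c) (hπ₀ : π₀ ∈ finitePlans μ ν c) :
    ∃ h, DualLE (bidualEmb π₀ (L1S μ ν π₀) h) (regular π₀ (costClass hc hπ₀)) ∧
      bidualEmb π₀ (L1S μ ν π₀) h (linftyOne π₀) = (primalValue μ ν c π₀).toReal :=
  have : IsProbabilityMeasure π₀ := hπ₀.1.1
  exists_bidual_le (const_one_mem_L1S hπ₀.1) fun _ => primalValue_toReal_le hc hπ₀

theorem neg_le_singular_density (hc : Measurable c) (hπ₀ : π₀ ∈ finitePlans μ ν c)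
    (hval : bidualEmb π₀ (L1S μ ν π₀) h (linftyOne π₀) = (primalValue μ ν c π₀).toReal)
    (hdec : IsDecomposition (bidualEmb π₀ (L1S μ ν π₀) h) hr hs) (hle : hr ≤ costClass hc hπ₀)
    (hπ : π ∈ boundedPlans μ ν π₀) {α : ℝ} (hα : 0 ≤ α)
    (hcost : ∫⁻ z, c z ∂π ≤ primalValue μ ν c π₀ + ENNReal.ofReal α) :
    -α ≤ hs (density hπ) := by
  have hP := primalValue_ne_top hπ₀
  have hcost' := ENNReal.toReal_mono (ENNReal.add_ne_top.2 ⟨hP, ENNReal.ofReal_ne_top⟩) hcost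
  rw [ENNReal.toReal_add hP ENNReal.ofReal_ne_top, ENNReal.toReal_ofReal hα,
    ← regular_costClass_density hc hπ₀ hπ, ← hval, ← bidualEmb_density hπ₀.1 hπ h, hdec.1,
    add_apply] at hcost'
  have hreg : regular π₀ hr (density hπ) ≤ regular π₀ (costClass hc hπ₀) (density hπ) :=
    regular_mono hle _ (density_nonneg hπ)
  linarith

theorem exists_oplus_isEscapingApprox
    (hdec : IsDecomposition (bidualEmb π₀ (L1S μ ν π₀) h) hr hs) (hs0 : DualLE hs 0) :
    ∃ (φ : ℕ → X → ℝ) (ψ : ℕ → Y → ℝ), ∃ u B,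
      (∀ n, Integrable (φ n) μ) ∧ (∀ n, Integrable (ψ n) ν) ∧
      IsEscapingApprox π₀ (fun n => oplus (φ n) (ψ n)) u hr B ‖hs‖ := by
  obtain ⟨f, u, B, hf, happ⟩ := exists_isEscapingApprox hs0.zero_le_neg hdec.2.neg
    (E := oplusSubmodule μ ν π₀) (r := hr) fun γ hγ => by
      have hzero := bidualEmb_eq_zero h (annihilator_L1S (μ := μ) (ν := ν) ▸ hγ)
      rw [hdec.1, add_apply] at hzero
      exact eq_neg_of_add_eq_zero_left hzero
  choose φ ψ hφ hψ hfφ using hf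
  rw [neg_apply, ← hs0.norm_eq_neg] at happ
  exact ⟨φ, ψ, _, B, hφ, hψ, happ.congr hfφ⟩

theorem tendsto_integral_of_isEscapingApprox (hπ₀ : π₀ ∈ transportPlans μ ν)
    (hdec : IsDecomposition (bidualEmb π₀ (L1S μ ν π₀) h) hr hs) (hs0 : DualLE hs 0)
    {φ : ℕ → X → ℝ} {ψ : ℕ → Y → ℝ} {u B} (hφ : ∀ n, Integrable (φ n) μ)
    (hψ : ∀ n, Integrable (ψ n) ν)
    (happ : IsEscapingApprox π₀ (fun n => oplus (φ n) (ψ n)) u hr B ‖hs‖) :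
    Tendsto (fun n => ∫ x, φ n x ∂μ + ∫ y, ψ n y ∂ν) atTop
      (𝓝 (bidualEmb π₀ (L1S μ ν π₀) h (linftyOne π₀))) := by
  have hlim := (happ.tendsto_setIntegral_add univ).sub_const ‖hs‖
  simp only [Measure.restrict_univ, happ.integral_escaping, add_sub_cancel_right,
    integral_oplus hπ₀ (hφ _) (hψ _)] at hlim
  rwa [hs0.norm_eq_neg, sub_neg_eq_add, ← regular_linftyOne, ← add_apply,
    ← hdec.1] at hlim

end DualOptimizer

end MongeKantorovich

end

theorem theorem3p1_general {X Y : Type*} [MeasurableSpace X] [MeasurableSpace Y]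
    (μ : Measure X) (ν : Measure Y) (c : X × Y → ℝ≥0∞) (hc : Measurable c)
    (π₀ : Measure (X × Y)) (hπ₀ : π₀ ∈ finitePlans μ ν c) :
    Tendsto (relaxedDualValue μ ν c π₀) (𝓝[>] 0) (𝓝 (dualValue μ ν c π₀)) ∧
    (primalValue μ ν c π₀ : EReal) = dualValue μ ν c π₀ ∧
    ∃ (h : StrongDual ℝ (StrongDual ℝ (L1S μ ν π₀))) (hr : Lp ℝ 1 π₀)
      (hs : StrongDual ℝ (Lp ℝ ∞ π₀)),
      IsDecomposition (bidualEmb π₀ (L1S μ ν π₀) h) hr hs ∧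
      DualLE (bidualEmb π₀ (L1S μ ν π₀) h) (regular π₀ (costClass hc hπ₀)) ∧
      (∀ᵐ z ∂π₀, ((hr z : ℝ) : EReal) ≤ (c z : EReal)) ∧
      DualLE hs 0 ∧
      dualValue μ ν c π₀ =
        ((bidualEmb π₀ (L1S μ ν π₀) h (density (mem_boundedPlans_self hπ₀)) : ℝ) : EReal) ∧
      (∀ (π : Measure (X × Y)) (hπ : π ∈ boundedPlans μ ν π₀) (α : ℝ), 0 ≤ α →
        ∫⁻ z, c z ∂π ≤ primalValue μ ν c π₀ + ENNReal.ofReal α →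
        -α ≤ hs (density hπ) ∧ hs (density hπ) ≤ 0) ∧
      (∀ π ∈ boundedPlans μ ν π₀, ∫⁻ z, c z ∂π = primalValue μ ν c π₀ →
        ∀ ε : ℝ≥0∞, 0 < ε → VanishesOn hs {z | ε < π.rnDeriv π₀ z}) ∧
      ∃ (φ : ℕ → X → ℝ) (ψ : ℕ → Y → ℝ),
        (∀ n, Integrable (φ n) μ) ∧ (∀ n, Integrable (ψ n) ν) ∧
        (∀ᵐ z ∂π₀, Tendsto (fun n => oplus (φ n) (ψ n) z) atTop (𝓝 (hr z))) ∧
        Tendsto (fun n => eLpNorm (fun z => max (oplus (φ n) (ψ n) z - hr z) 0) 1 π₀)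
          atTop (𝓝 0) ∧
        Tendsto (escapeLim π₀ (fun n => oplus (φ n) (ψ n))) (𝓝[>] 0) (𝓝 ((‖hs‖ : ℝ) : EReal)) ∧
        Tendsto (escapeInf π₀ (fun n => oplus (φ n) (ψ n))) (𝓝[>] 0) (𝓝 ((‖hs‖ : ℝ) : EReal)) ∧
        Tendsto (escapeSup π₀ (fun n => oplus (φ n) (ψ n))) (𝓝[>] 0) (𝓝 ((‖hs‖ : ℝ) : EReal)) := by
  have : IsProbabilityMeasure π₀ := hπ₀.1.1
  obtain ⟨h, hle, hval⟩ := exists_bidual_le_costClass hc hπ₀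
  obtain ⟨hr, hs, hdec, hrc, hs0⟩ := exists_isDecomposition_of_dualLE_regular hle
  obtain ⟨φ, ψ, u, B, hφ, hψ, happ⟩ := exists_oplus_isEscapingApprox hdec hs0
  have hP := EReal.coe_ennreal_toReal (primalValue_ne_top hπ₀)
  have hlim := tendsto_integral_of_isEscapingApprox hπ₀.1 hdec hs0 hφ hψ happ
  have hdual : Tendsto (relaxedDualValue μ ν c π₀) (𝓝[>] 0) (𝓝 (primalValue μ ν c π₀)) :=
    tendsto_relaxedDualValue hc hπ₀ fun ε hε => by
      rw [← hP, ← hval]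
      exact le_relaxedDualValue hφ hψ (ae_coe_le_cost hc hπ₀ hrc) happ.tendsto_eLpNorm_max hlim hε
  have hdualValue : dualValue μ ν c π₀ = primalValue μ ν c π₀ := hdual.limUnder_eq
  have hsing : ∀ (π : Measure (X × Y)) (hπ : π ∈ boundedPlans μ ν π₀) (α : ℝ), 0 ≤ α →
      ∫⁻ z, c z ∂π ≤ primalValue μ ν c π₀ + ENNReal.ofReal α →
      -α ≤ hs (density hπ) ∧ hs (density hπ) ≤ 0 := fun π hπ α hα hcost =>
    ⟨neg_le_singular_density hc hπ₀ hval hdec hrc hπ hα hcost, hs0 _ (density_nonneg hπ)⟩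
  refine ⟨hdualValue ▸ hdual, hdualValue.symm, h, hr, hs, hdec, hle,
    ae_coe_le_cost hc hπ₀ hrc, hs0, ?_, hsing, fun π hπ hopt ε hε => ?_, φ, ψ, hφ, hψ,
    happ.ae_tendsto, happ.tendsto_eLpNorm_max,
    happ.tendsto_escape le_rfl ((escapeLim_le_escapeInf _).trans (escapeInf_le_escapeSup _)),
    happ.tendsto_escape (escapeLim_le_escapeInf _) (escapeInf_le_escapeSup _),
    happ.tendsto_escape ((escapeLim_le_escapeInf _).trans (escapeInf_le_escapeSup _)) le_rfl⟩
  · rw [hdualValue, bidualEmb_density hπ₀.1, hval, hP]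
  · have hzero := hsing π hπ 0 le_rfl (hopt.le.trans le_self_add)
    exact vanishesOn_lt_rnDeriv hs0 hπ (le_antisymm hzero.2 (neg_zero.symm.le.trans hzero.1)) hε

theorem theorem3p1 {X Y : Type*}
    [TopologicalSpace X] [PolishSpace X] [MeasurableSpace X] [BorelSpace X]
    [TopologicalSpace Y] [PolishSpace Y] [MeasurableSpace Y] [BorelSpace Y]
    (μ : Measure X) [IsProbabilityMeasure μ] (ν : Measure Y) [IsProbabilityMeasure ν]
    (c : X × Y → ℝ≥0∞) (hc : Measurable c)
    (π₀ : Measure (X × Y)) (hπ₀ : π₀ ∈ finitePlans μ ν c) :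
    -- the limit defining the dual value exists, and there is no duality gap
    Tendsto (relaxedDualValue μ ν c π₀) (𝓝[>] 0) (𝓝 (dualValue μ ν c π₀)) ∧
    (primalValue μ ν c π₀ : EReal) = dualValue μ ν c π₀ ∧
    -- `h` is the dual optimizer, `hr` its regular part and `hs` its purely singular part
    ∃ (h : StrongDual ℝ (StrongDual ℝ (L1S μ ν π₀))) (hr : Lp ℝ 1 π₀)
      (hs : StrongDual ℝ (Lp ℝ ∞ π₀)),
      IsDecomposition (bidualEmb π₀ (L1S μ ν π₀) h) hr hs ∧
      DualLE (bidualEmb π₀ (L1S μ ν π₀) h) (regular π₀ (costClass hc hπ₀)) ∧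
      (∀ᵐ z ∂π₀, ((hr z : ℝ) : EReal) ≤ (c z : EReal)) ∧
      DualLE hs 0 ∧
      dualValue μ ν c π₀ =
        ((bidualEmb π₀ (L1S μ ν π₀) h (density (mem_boundedPlans_self hπ₀)) : ℝ) : EReal) ∧
      (∀ (π : Measure (X × Y)) (hπ : π ∈ boundedPlans μ ν π₀) (α : ℝ), 0 ≤ α →
        ∫⁻ z, c z ∂π ≤ primalValue μ ν c π₀ + ENNReal.ofReal α →
        -α ≤ hs (density hπ) ∧ hs (density hπ) ≤ 0) ∧
      (∀ π ∈ boundedPlans μ ν π₀, ∫⁻ z, c z ∂π = primalValue μ ν c π₀ →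
        ∀ ε : ℝ≥0∞, 0 < ε → VanishesOn hs {z | ε < π.rnDeriv π₀ z}) ∧
      ∃ (φ : ℕ → X → ℝ) (ψ : ℕ → Y → ℝ),
        (∀ n, Integrable (φ n) μ) ∧ (∀ n, Integrable (ψ n) ν) ∧
        (∀ᵐ z ∂π₀, Tendsto (fun n => oplus (φ n) (ψ n) z) atTop (𝓝 (hr z))) ∧
        Tendsto (fun n => eLpNorm (fun z => max (oplus (φ n) (ψ n) z - hr z) 0) 1 π₀)
          atTop (𝓝 0) ∧
        Tendsto (escapeLim π₀ (fun n => oplus (φ n) (ψ n))) (𝓝[>] 0) (𝓝 ((‖hs‖ : ℝ) : EReal)) ∧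
        Tendsto (escapeInf π₀ (fun n => oplus (φ n) (ψ n))) (𝓝[>] 0) (𝓝 ((‖hs‖ : ℝ) : EReal)) ∧
        Tendsto (escapeSup π₀ (fun n => oplus (φ n) (ψ n))) (𝓝[>] 0) (𝓝 ((‖hs‖ : ℝ) : EReal)) :=
  theorem3p1_general μ ν c hc π₀ hπ₀
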